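/- Let $(M,\mathcal O)$ be a formal manifold: a locally ringed space over $\mathrm{Spec}(\mathbb C)$ whose underlying space is paracompact and Hausdorff and in which every point has an open neighbourhood $U$ such that, for some $n,k\in\mathbb N$ (depending on the point), $(U,\mathcal O|_U)$ is isomorphic over $\mathrm{Spec}(\mathbb C)$ to $\mathbb R^n$ with the sheaf $V\mapsto C^\infty(V)[[y_1,\dots,y_k]]$ (complex-valued smooth functions). Let $\underline{\mathcal O}$ be the reduction of $\mathcal O$, i.e. the image of $\mathcal O$ in the sheaf of complex-valued functions on $M$ under $f\mapsto(a\mapsto f(a))$, where $f(a)$ is the class of $f$ in $\mathcal O_a/\mathfrak m_a=\mathbb C$. Let $\mathcal F$ be a sheaf of $\mathcal O$-modules and let $E$ be a quasi-complete Hausdorff locally convex space over $\mathbb C$. For $U\subseteq M$ open, equip $\mathcal F(U)$ with the smooth topology, i.e. the locally convex topology defined by the seminorms $|u|_D=\sup_{a\in U}|(Du)(a)|$, where $D$ runs over all compactly supported differential operators $\mathcal F|_U\to\underline{\mathcal O}|_U$ (morphisms of sheaves of complex vector spaces, locally of finite order with respect to $\mathcal O$, with compact support in $U$). For $K\subseteq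 U$ compact, let $\mathcal F_K(U)\subseteq\mathcal F(U)$ be the subspace of sections supported in $K$, with the subspace topology. Let $\mathcal F_c(U)=\varinjlim_K\mathcal F_K(U)$ be the space of compactly supported sections, with the inductive limit topology in the category of locally convex spaces. Let $\mathrm D^{-\infty}(U;\mathcal F;E)=\mathcal L_b(\mathcal F_c(U),E)$ be the space of continuous linear maps with the topology of uniform convergence on bounded sets. For every open $U\subseteq M$ let $\mathrm{ext}_{M,U}:\mathcal F_c(U)\to\mathcal F_c(M)$ denote extension by zero. Let $\{U_\gamma\}_{\gamma\in\Gamma}$ be an open cover of $M$ and suppose that $\mathcal F(M)$ is Hausdorff. Then the maps $\mathrm{ext}_{M,U_\gamma}$ are continuous, so that the restrictions $\eta|_{U_\gamma}:=\eta\circ\mathrm{ext}_{M,U_\gamma}$ are defined, and the linear map $$\mathrm D^{-\infty}(M;\mathcal F;E)\longrightarrow\prod_{\gamma\in\Gamma}\mathrm D^{-\infty}(U_\gamma;\mathcal F;E),\qquad \eta\mapsto\{\eta|_{U_\gamma}\}_{\gamma\in\Gamma},$$ is a closed topological embedding (a homeomorphism onto a closed subspace of the product). -/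

import Mathlib

open AlgebraicGeometry CategoryTheory TopologicalSpace Opposite Topology
open scoped ContDiff Manifold

universe u v w

namespace FormalMfd

noncomputable section

/-! ### The local models `(ℝⁿ)^(k)` -/

/-- `C^∞(V)`: the `ℂ`-algebra of complex-valued smooth functions on an open subset `V ⊆ ℝⁿ`. -/
def smoothFun {n : ℕ} (V : Opens (EuclideanSpace ℝ (Fin n))) : Subalgebra ℂ (V → ℂ) where
  carrier := {f | ContMDiff 𝓘(ℝ, EuclideanSpace ℝ (Fin n)) 𝓘(ℝ, ℂ) ∞ f}
  mul_mem' hf hg := contDiff_mul.contMDiff.comp (hf.prodMk_space hg)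
  add_mem' hf hg := hf.add hg
  algebraMap_mem' _ := contMDiff_const

/-- Restriction of smooth functions. -/
def smoothFun.res {n : ℕ} {V V' : Opens (EuclideanSpace ℝ (Fin n))} (h : V' ≤ V) :
    smoothFun V →ₐ[ℂ] smoothFun V' where
  toFun f := ⟨fun x => f.1 ⟨x.1, h x.2⟩, ContMDiff.comp f.2 (contMDiff_inclusion h)⟩
  map_one' := rfl
  map_mul' _ _ := rfl
  map_zero' := rfl
  map_add' _ _ := rfl
  commutes' _ := rfl

/-! ### Formal manifolds -/

/-- The scheme `Spec ℂ` as a locally ringed space (with the universe of `ℂ` adjusted). -/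
abbrev SpecC : LocallyRingedSpace.{u} :=
  Spec.locallyRingedSpaceObj (CommRingCat.of (ULift.{u} ℂ))

/-- Restriction of sections of the structure sheaf of a locally ringed space. -/
def funRes (X : LocallyRingedSpace.{u}) {U V : Opens X} (h : V ≤ U) :
    X.presheaf.obj (op U) →+* X.presheaf.obj (op V) :=
  (X.presheaf.map (homOfLE h).op).hom

/-- The constants `ℂ → 𝒪(U)` of a locally ringed space over `Spec ℂ`, obtained from the structure
morphism on global sections. -/
def constants {X : LocallyRingedSpace.{u}} (p : X ⟶ SpecC.{u}) (U : Opens X) :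
    ℂ →+* X.presheaf.obj (op U) :=
  (funRes X (le_top : U ≤ ⊤)).comp
    ((toSpecΓ (CommRingCat.of (ULift.{u} ℂ)) ≫ LocallyRingedSpace.Γ.map p.op).hom.comp
      (ULift.ringEquiv.{0, u} (R := ℂ)).symm.toRingHom)

/-- The open subset of `X` corresponding to an open subset `V ⊆ ℝⁿ` under a homeomorphism
`U ≃ ℝⁿ`. -/
def pull {X : Type u} [TopologicalSpace X] {U : Opens X} {n : ℕ}
    (e : U ≃ₜ EuclideanSpace ℝ (Fin n)) (V : Opens (EuclideanSpace ℝ (Fin n))) : Opens X where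
  carrier := Subtype.val '' (e ⁻¹' (V : Set (EuclideanSpace ℝ (Fin n))))
  is_open' := U.2.isOpenMap_subtype_val _ (V.2.preimage e.continuous)

theorem pull_mono {X : Type u} [TopologicalSpace X] {U : Opens X} {n : ℕ}
    (e : U ≃ₜ EuclideanSpace ℝ (Fin n)) {V V' : Opens (EuclideanSpace ℝ (Fin n))} (h : V' ≤ V) :
    pull e V' ≤ pull e V :=
  Set.image_mono (Set.preimage_mono h)

/-- An isomorphism `(U, 𝒪|_U) ≅ (ℝⁿ)^(k)` over `Spec ℂ`: a homeomorphism together with an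
isomorphism of the sheaf `V ↦ C^∞(V)[[y₁, …, y_k]]` with the transported structure sheaf, as sheaves
of `ℂ`-algebras. (An isomorphism of ringed spaces is automatically local on stalks.) -/
structure Chart {X : LocallyRingedSpace.{u}} (p : X ⟶ SpecC.{u}) (U : Opens X) (n k : ℕ) where
  /-- the homeomorphism of the underlying spaces -/
  homeo : U ≃ₜ EuclideanSpace ℝ (Fin n)
  /-- the isomorphism on sections -/
  iso : ∀ V : Opens (EuclideanSpace ℝ (Fin n)),
    X.presheaf.obj (op (pull homeo V)) ≃+* MvPowerSeries (Fin k) (smoothFun V)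
  iso_constants : ∀ (V : Opens (EuclideanSpace ℝ (Fin n))) (c : ℂ),
    iso V (constants p _ c) = MvPowerSeries.C (algebraMap ℂ (smoothFun V) c)
  iso_res : ∀ (V V' : Opens (EuclideanSpace ℝ (Fin n))) (h : V' ≤ V)
    (f : X.presheaf.obj (op (pull homeo V))),
    iso V' (funRes X (pull_mono homeo h) f) =
      MvPowerSeries.map (smoothFun.res h).toRingHom (iso V f)

end

end FormalMfd

/-- A formal manifold: a locally ringed space over `Spec ℂ`, with paracompact Hausdorff underlying
space, that is locally isomorphic to `(ℝⁿ)^(k)` with `n`, `k` depending on the point. -/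
structure FormalManifold where
  /-- the locally ringed space -/
  toLRS : LocallyRingedSpace.{u}
  /-- the structure morphism -/
  toSpec : toLRS ⟶ FormalMfd.SpecC.{u}
  t2 : T2Space toLRS
  paracompact : ParacompactSpace toLRS
  exists_chart : ∀ a : toLRS, ∃ (U : Opens toLRS) (_ : a ∈ U) (n k : ℕ),
    Nonempty (FormalMfd.Chart toSpec U n k)

namespace FormalManifold

open FormalMfd

noncomputable section

variable (M : FormalManifold.{u})

instance : CoeSort FormalManifold.{u} (Type u) := ⟨fun M => M.toLRS⟩

instance : TopologicalSpace M := inferInstanceAs (TopologicalSpace M.toLRS)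

instance : T2Space M := M.t2

instance : ParacompactSpace M := M.paracompact

/-- `𝒪(U)`, the ring of formal functions on the open subset `U`. -/
abbrev Fun (U : Opens M) : Type u := M.toLRS.presheaf.obj (op U)

/-- Restriction of formal functions. -/
abbrev funRes {U V : Opens M} (h : V ≤ U) : M.Fun U →+* M.Fun V := FormalMfd.funRes M.toLRS h

instance (U : Opens M) : Algebra ℂ (M.Fun U) := (constants M.toSpec U).toAlgebra

theorem funRes_funRes {U V W : Opens M} (h : V ≤ U) (h' : W ≤ V) (f : M.Fun U) :
    M.funRes h' (M.funRes h f) = M.funRes (h'.trans h) f := by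
  have := M.toLRS.presheaf.map_comp (homOfLE h).op (homOfLE h').op
  exact (congrArg (fun g => g.hom f) this).symm

theorem funRes_algebraMap {U V : Opens M} (h : V ≤ U) (c : ℂ) :
    M.funRes h (algebraMap ℂ (M.Fun U) c) = algebraMap ℂ (M.Fun V) c :=
  M.funRes_funRes le_top h _

/-! ### Values of formal functions and the reduction -/

/-- The map `ℂ → κ(a)` to the residue field `κ(a) = 𝒪_a / 𝔪_a`. -/
def toResidue (a : M) : ℂ →+* M.toLRS.residueField a :=
  (M.toLRS.evaluation (U := ⊤) ⟨a, trivial⟩).hom.comp (algebraMap ℂ (M.Fun ⊤))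

theorem evaluation_res {U V : Opens M} (h : V ≤ U) (f : M.Fun U) (a : M) (ha : a ∈ V) :
    (M.toLRS.evaluation (U := V) ⟨a, ha⟩).hom (M.funRes h f) =
      (M.toLRS.evaluation (U := U) ⟨a, h ha⟩).hom f := by
  simp only [LocallyRingedSpace.evaluation]
  have := M.toLRS.presheaf.germ_res (homOfLE h) a ha
  exact congrArg (fun g => (M.toLRS.residue a).hom (g.hom f)) this

theorem toResidue_eq {U : Opens M} (a : M) (ha : a ∈ U) (c : ℂ) :
    M.toResidue a c = (M.toLRS.evaluation (U := U) ⟨a, ha⟩).hom (algebraMap ℂ (M.Fun U) c) := by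
  rw [← M.funRes_algebraMap (le_top : U ≤ ⊤), M.evaluation_res]
  rfl


theorem mem_pull {X : Type u} [TopologicalSpace X] {U : Opens X} {n : ℕ}
    (e : U ≃ₜ EuclideanSpace ℝ (Fin n)) {V : Opens (EuclideanSpace ℝ (Fin n))}
    {x : EuclideanSpace ℝ (Fin n)} (hx : x ∈ V) : (e.symm x : X) ∈ pull e V :=
  ⟨e.symm x, by simpa using hx, rfl⟩

/-- The open subset of `ℝⁿ` corresponding to `W ∩ U` in a chart on `U`. -/
def push {X : Type u} [TopologicalSpace X] {U : Opens X} {n : ℕ}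
    (e : U ≃ₜ EuclideanSpace ℝ (Fin n)) (W : Opens X) : Opens (EuclideanSpace ℝ (Fin n)) where
  carrier := {x | (e.symm x : X) ∈ W}
  is_open' := W.2.preimage (continuous_subtype_val.comp e.symm.continuous)

theorem pull_push_le {X : Type u} [TopologicalSpace X] {U : Opens X} {n : ℕ}
    (e : U ≃ₜ EuclideanSpace ℝ (Fin n)) (W : Opens X) : pull e (push e W) ≤ W := by
  rintro _ ⟨b, hb, rfl⟩
  simpa [push] using hb

variable {M} in
theorem evaluation_eq_zero_of_chart {U : Opens M} {n k : ℕ} (C : Chart M.toSpec U n k)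
    {V : Opens (EuclideanSpace ℝ (Fin n))} (f : M.Fun (pull C.homeo V))
    {x : EuclideanSpace ℝ (Fin n)} (hx : x ∈ V)
    (h : (MvPowerSeries.constantCoeff (C.iso V f)).1 ⟨x, hx⟩ = 0) :
    (M.toLRS.evaluation (U := pull C.homeo V) ⟨C.homeo.symm x, mem_pull C.homeo hx⟩).hom f = 0 := by
  by_contra hne
  have hmem := (M.toLRS.evaluation_ne_zero_iff_mem_basicOpen _ _).1 hne
  rw [RingedSpace.mem_basicOpen _ _ _ (mem_pull C.homeo hx)] at hmem
  obtain ⟨W, i, hxW, hu⟩ := RingedSpace.isUnit_res_of_isUnit_germ _ _ _ _ _ hmem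
  have hle : push C.homeo W ≤ V := by
    intro y hy
    obtain ⟨b, hb, hb'⟩ := i.le hy
    have : b = C.homeo.symm y := Subtype.ext hb'
    subst this
    simpa using hb
  have hu1 : IsUnit (M.funRes i.le f) := hu
  have hu2 := hu1.map (M.funRes (pull_push_le C.homeo W))
  rw [funRes_funRes] at hu2
  have hu3 := (hu2.map (C.iso _)).map (MvPowerSeries.constantCoeff (R := smoothFun _))
  have key := C.iso_res V _ hle f
  have hu4 : IsUnit (MvPowerSeries.constantCoeff (C.iso (push C.homeo W)
      (FormalMfd.funRes M.toLRS (pull_mono C.homeo hle) f))) := hu3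
  rw [key, ← MvPowerSeries.coeff_zero_eq_constantCoeff_apply, MvPowerSeries.coeff_map,
    MvPowerSeries.coeff_zero_eq_constantCoeff_apply] at hu4
  have hu5 := (hu4.map (smoothFun (push C.homeo W)).val).map (Pi.evalRingHom (fun _ => ℂ) ⟨x, hxW⟩)
  exact hu5.ne_zero h

variable {M} in
theorem evaluation_chart {U : Opens M} {n k : ℕ} (C : Chart M.toSpec U n k)
    {V : Opens (EuclideanSpace ℝ (Fin n))} (f : M.Fun (pull C.homeo V))
    {x : EuclideanSpace ℝ (Fin n)} (hx : x ∈ V) :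
    (M.toLRS.evaluation (U := pull C.homeo V) ⟨C.homeo.symm x, mem_pull C.homeo hx⟩).hom f =
      M.toResidue (C.homeo.symm x)
        ((MvPowerSeries.constantCoeff (C.iso V f)).1 ⟨x, hx⟩) := by
  set c := (MvPowerSeries.constantCoeff (C.iso V f)).1 ⟨x, hx⟩ with hc
  rw [M.toResidue_eq _ (mem_pull C.homeo hx), ← sub_eq_zero, ← map_sub]
  apply evaluation_eq_zero_of_chart C _ hx
  rw [map_sub]
  have := C.iso_constants V c
  rw [show C.iso V (algebraMap ℂ _ c) = _ from this]
  simp [hc]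

theorem toResidue_bijective (a : M) : Function.Bijective (M.toResidue a) := by
  refine ⟨(M.toResidue a).injective, ?_⟩
  obtain ⟨U, haU, n, k, ⟨C⟩⟩ := M.exists_chart a
  obtain ⟨x, rfl⟩ : ∃ x, (C.homeo.symm x : M) = a := ⟨C.homeo ⟨a, haU⟩, by simp⟩
  intro z
  obtain ⟨g, rfl⟩ := M.toLRS.residue_surjective _ z
  obtain ⟨W, haW, f, rfl⟩ := TopCat.Presheaf.exists_germ_eq M.toLRS.presheaf g
  have := evaluation_chart C (M.funRes (pull_push_le C.homeo W) f) (x := x) haW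
  rw [evaluation_res] at this
  exact ⟨_, this.symm⟩

/-- The identification `ℂ ≃ κ(a)`. -/
def residueEquiv (a : M) : ℂ ≃+* M.toLRS.residueField a :=
  RingEquiv.ofBijective (M.toResidue a) (M.toResidue_bijective a)

/-- The homomorphism sending a formal function `f` on `U` to the function `a ↦ f(a)` on `U`, where
`f(a) ∈ ℂ` is the image of `f` in `κ(a) = ℂ`. -/
def value (U : Opens M) : M.Fun U →+* (U → ℂ) :=
  RingHom.pi fun a => (M.residueEquiv a).symm.toRingHom.comp (M.toLRS.evaluation a).hom

theorem value_eq_iff {U : Opens M} (f : M.Fun U) (a : U) (c : ℂ) :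
    M.value U f a = c ↔ (M.toLRS.evaluation a).hom f = M.toResidue a c :=
  (M.residueEquiv a).symm_apply_eq

theorem value_algebraMap (U : Opens M) (c : ℂ) (a : U) :
    M.value U (algebraMap ℂ (M.Fun U) c) a = c := by
  rw [value_eq_iff, M.toResidue_eq a a.2]

theorem value_res {U V : Opens M} (h : V ≤ U) (f : M.Fun U) (a : V) :
    M.value V (M.funRes h f) a = M.value U f ⟨a, h a.2⟩ := by
  rw [value_eq_iff, M.evaluation_res h f a a.2]
  exact (M.value_eq_iff f ⟨a, h a.2⟩ _).1 rfl

theorem continuous_value {U : Opens M} (f : M.Fun U) : Continuous (M.value U f) := by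
  rw [continuous_iff_continuousAt]
  intro a
  obtain ⟨W, haW, n, k, ⟨C⟩⟩ := M.exists_chart a
  set V := push C.homeo U
  set φ := MvPowerSeries.constantCoeff (C.iso V (M.funRes (pull_push_le C.homeo U) f)) with hφ
  have hval : ∀ (x : EuclideanSpace ℝ (Fin n)) (hx : x ∈ V),
      M.value U f ⟨C.homeo.symm x, hx⟩ = φ.1 ⟨x, hx⟩ := by
    intro x hx
    have := evaluation_chart C (M.funRes (pull_push_le C.homeo U) f) hx
    rw [evaluation_res] at this
    exact (M.value_eq_iff _ _ _).2 this
  have hmem : ∀ b : U, ∀ hb : (b : M) ∈ W, C.homeo ⟨b, hb⟩ ∈ V := by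
    intro b hb
    change ((C.homeo.symm (C.homeo ⟨b, hb⟩) : W) : M) ∈ U
    simp
  let T : Set U := {b | (b : M) ∈ W}
  have hT : IsOpen T := W.2.preimage continuous_subtype_val
  refine ContinuousOn.continuousAt (s := T) ?_ (hT.mem_nhds haW)
  rw [continuousOn_iff_continuous_domRestrict]
  have hcont : Continuous fun b : T => φ.1 ⟨C.homeo ⟨b.1, b.2⟩, hmem b.1 b.2⟩ := by
    refine (ContMDiff.continuous φ.2).comp (Continuous.subtype_mk (C.homeo.continuous.comp ?_) _)
    exact Continuous.subtype_mk (continuous_subtype_val.comp continuous_subtype_val) _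
  convert hcont using 1
  funext b
  have := hval _ (hmem b.1 b.2)
  simpa using this

/-- Sections over `U` of the reduction `𝒪_red` of `𝒪`, i.e. of the image of `𝒪` in the sheaf of
complex-valued functions under `f ↦ (a ↦ f(a))`. -/
def Reduced (U : Opens M) : Subalgebra ℂ (U → ℂ) where
  carrier := {φ | ∀ a : U, ∃ (V : Opens M) (h : V ≤ U) (_ : (a : M) ∈ V) (f : M.Fun V),
    ∀ b : V, φ ⟨b, h b.2⟩ = M.value V f b}
  mul_mem' := by
    intro φ ψ hφ hψ a
    obtain ⟨V, h, ha, f, hf⟩ := hφ a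
    obtain ⟨V', h', ha', f', hf'⟩ := hψ a
    refine ⟨V ⊓ V', inf_le_left.trans h, ⟨ha, ha'⟩,
      M.funRes inf_le_left f * M.funRes inf_le_right f', fun b => ?_⟩
    rw [map_mul, Pi.mul_apply, Pi.mul_apply, value_res, value_res]
    exact congrArg₂ _ (hf ⟨b, b.2.1⟩) (hf' ⟨b, b.2.2⟩)
  add_mem' := by
    intro φ ψ hφ hψ a
    obtain ⟨V, h, ha, f, hf⟩ := hφ a
    obtain ⟨V', h', ha', f', hf'⟩ := hψ a
    refine ⟨V ⊓ V', inf_le_left.trans h, ⟨ha, ha'⟩,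
      M.funRes inf_le_left f + M.funRes inf_le_right f', fun b => ?_⟩
    rw [map_add, Pi.add_apply, Pi.add_apply, value_res, value_res]
    exact congrArg₂ _ (hf ⟨b, b.2.1⟩) (hf' ⟨b, b.2.2⟩)
  algebraMap_mem' c a :=
    ⟨U, le_rfl, a.2, algebraMap ℂ _ c, fun b => (M.value_algebraMap U c b).symm⟩

theorem continuous_reduced {U : Opens M} (φ : M.Reduced U) : Continuous φ.1 := by
  rw [continuous_iff_continuousAt]
  intro a
  obtain ⟨V, h, ha, f, hf⟩ := φ.2 a
  let T : Set U := {b | (b : M) ∈ V}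
  have hT : IsOpen T := V.2.preimage continuous_subtype_val
  refine ContinuousOn.continuousAt (s := T) ?_ (hT.mem_nhds ha)
  rw [continuousOn_iff_continuous_domRestrict]
  have : Continuous fun b : T => M.value V f ⟨b.1, b.2⟩ :=
    (M.continuous_value f).comp
      (Continuous.subtype_mk (continuous_subtype_val.comp continuous_subtype_val) _)
  convert this using 1
  funext b
  exact hf ⟨b.1, b.2⟩

/-- The reduction homomorphism `𝒪(U) → 𝒪_red(U)`. -/
def toReduced (U : Opens M) : M.Fun U →+* M.Reduced U :=
  (M.value U).codRestrict (M.Reduced U) fun f a => ⟨U, le_rfl, a.2, f, fun _ => rfl⟩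

instance (U : Opens M) : Module (M.Fun U) (M.Reduced U) := Module.compHom _ (M.toReduced U)

/-- Restriction in the sheaf `𝒪_red`. -/
def redRes {U V : Opens M} (h : V ≤ U) : M.Reduced U →ₗ[ℂ] M.Reduced V where
  toFun φ := ⟨fun a => φ.1 ⟨a, h a.2⟩, fun a => by
    obtain ⟨W, hW, ha, f, hf⟩ := φ.2 ⟨a, h a.2⟩
    exact ⟨W ⊓ V, inf_le_right, ⟨ha, a.2⟩, M.funRes inf_le_left f, fun b => by
      rw [value_res]; exact hf ⟨b, b.2.1⟩⟩⟩
  map_add' _ _ := rfl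
  map_smul' _ _ := rfl

/-! ### Sheaves of `𝒪`-modules -/

/-- The structure sheaf as a sheaf of rings. -/
abbrev ringSheaf : TopCat.Sheaf RingCat.{u} M.toLRS.toTopCat :=
  (sheafCompose (Opens.grothendieckTopology M.toLRS.toTopCat)
    (forget₂ CommRingCat.{u} RingCat.{u})).obj M.toLRS.sheaf

/-- Sheaves of `𝒪`-modules on `M`. -/
abbrev Modules : Type _ := SheafOfModules.{v} M.ringSheaf

end

end FormalManifold

namespace FormalMfd

noncomputable section

variable {M : FormalManifold.{u}}

/-- The `𝒪(U)`-module `F(U)`. -/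
def Sec (F : FormalManifold.Modules.{u, v} M) (U : Opens M) : Type v := F.val.obj (op U)

variable (F : FormalManifold.Modules.{u, v} M)

instance (U : Opens M) : AddCommGroup (Sec F U) := inferInstanceAs (AddCommGroup (F.val.obj (op U)))

instance (U : Opens M) : Module (M.Fun U) (Sec F U) :=
  inferInstanceAs (Module (M.ringSheaf.obj.obj (op U)) (F.val.obj (op U)))

instance (U : Opens M) : Module ℂ (Sec F U) := Module.compHom _ (algebraMap ℂ (M.Fun U))

instance (U : Opens M) : IsScalarTower ℂ (M.Fun U) (Sec F U) :=
  IsScalarTower.of_algebraMap_smul fun _ _ => rfl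

/-- Restriction of sections of `F`. -/
def res {U V : Opens M} (h : V ≤ U) : Sec F U →ₗ[ℂ] Sec F V where
  toFun := (F.val.map (homOfLE h).op).hom
  map_add' := map_add _
  map_smul' c u := by
    refine (F.val.map_smul (homOfLE h).op (algebraMap ℂ (M.Fun U) c) u).trans ?_
    exact congrArg (fun f : M.Fun V => f • (show Sec F V from (F.val.map (homOfLE h).op).hom u))
      (M.funRes_algebraMap h c)

theorem res_smul {U V : Opens M} (h : V ≤ U) (f : M.Fun U) (u : Sec F U) :
    res F h (f • u) = M.funRes h f • res F h u :=
  F.val.map_smul (homOfLE h).op f u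

theorem res_res {U V W : Opens M} (h : V ≤ U) (h' : W ≤ V) (u : Sec F U) :
    res F h' (res F h u) = res F (h'.trans h) u := by
  have := F.val.presheaf.map_comp (homOfLE h).op (homOfLE h').op
  exact (congrArg (fun g => g.hom u) this).symm

theorem res_self {U : Opens M} (u : Sec F U) : res F le_rfl u = u := by
  have := F.val.presheaf.map_id (op U)
  exact congrArg (fun g => g.hom u) this

/-- The presheaf of sets underlying `F` is a sheaf. -/
theorem isSheaf_types :
    TopCat.Presheaf.IsSheaf (X := M.toLRS.toTopCat) (F.val.presheaf ⋙ forget AddCommGrpCat) :=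
  (Presheaf.isSheaf_of_iso_iff
    (Functor.isoWhiskerLeft F.val.presheaf AddCommGrpCat.coyonedaObjIsoForget)).1
    ((isSheaf_iff_isSheaf_of_type _ _).2 (F.isSheaf _))

/-- Gluing of compatible sections. -/
theorem existsUnique_gluing {ι : Type*} (U : ι → Opens M) (W : Opens M) (hW : iSup U = W)
    (s : ∀ i, Sec F (U i))
    (hs : ∀ i j, res F (inf_le_left : U i ⊓ U j ≤ U i) (s i) = res F inf_le_right (s j)) :
    ∃! w : Sec F W, ∀ i, res F (hW ▸ le_iSup U i) w = s i := by
  subst hW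
  exact TopCat.Presheaf.IsSheaf.isSheafUniqueGluing_types (isSheaf_types F) (U := U) s
    fun i j => hs i j

theorem eq_of_locally_eq {W : Opens M} (u v : Sec F W)
    (h : ∀ a ∈ W, ∃ (V : Opens M) (hV : V ≤ W), a ∈ V ∧ res F hV u = res F hV v) : u = v := by
  choose! V hV haV heq using h
  have hcov : (⨆ a : W, V a) = W :=
    le_antisymm (iSup_le fun a => hV a a.2) fun a ha => by
      simp only [Opens.mem_iSup]
      exact ⟨⟨a, ha⟩, haV a ha⟩
  have := existsUnique_gluing F (fun a : W => V a) W hcov (fun a => res F (hV a a.2) u)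
    (fun i j => by rw [res_res, res_res])
  exact this.unique (fun _ => rfl) fun a => (heq a a.2).symm

/-! ### Supports and extension by zero -/

/-- The support of a section. -/
def support {U : Opens M} (u : Sec F U) : Set M :=
  {a | a ∈ U ∧ ∀ (V : Opens M) (h : V ≤ U), a ∈ V → res F h u ≠ 0}

variable {F} in
theorem notMem_support {U : Opens M} {u : Sec F U} {a : M} (ha : a ∈ U) :
    a ∉ support F u ↔ ∃ (V : Opens M) (h : V ≤ U), a ∈ V ∧ res F h u = 0 := by
  change ¬(a ∈ U ∧ ∀ (V : Opens M) (h : V ≤ U), a ∈ V → res F h u ≠ 0) ↔ _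
  push Not
  exact ⟨fun h => h ha, fun h _ => h⟩

theorem support_zero (U : Opens M) : support F (0 : Sec F U) = ∅ :=
  Set.eq_empty_of_forall_notMem fun _ ha => ha.2 U le_rfl ha.1 (map_zero _)

theorem support_add {U : Opens M} (u v : Sec F U) :
    support F (u + v) ⊆ support F u ∪ support F v := by
  intro a ha
  by_contra hn
  rw [Set.mem_union, not_or] at hn
  obtain ⟨V, h, haV, hu⟩ := (notMem_support ha.1).1 hn.1
  obtain ⟨V', h', haV', hv⟩ := (notMem_support ha.1).1 hn.2
  refine ha.2 (V ⊓ V') (inf_le_left.trans h) ⟨haV, haV'⟩ ?_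
  rw [map_add, ← res_res F h inf_le_left, ← res_res F h' inf_le_right, hu, hv, map_zero, map_zero,
    add_zero]

theorem support_smul {U : Opens M} (c : ℂ) (u : Sec F U) :
    support F (c • u) ⊆ support F u := fun _ ha =>
  ⟨ha.1, fun V h haV h0 => ha.2 V h haV (by rw [map_smul, h0, smul_zero])⟩

/-- `F_K(U)`: the sections over `U` supported in `K`. -/
def secSupportedIn (U : Opens M) (K : Set M) : Submodule ℂ (Sec F U) where
  carrier := {u | support F u ⊆ K}
  zero_mem' := by simp [support_zero]
  add_mem' hu hv := (support_add F _ _).trans (Set.union_subset hu hv)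
  smul_mem' _ _ hu := (support_smul F _ _).trans hu

/-- The subspace of compactly supported sections over `U`. -/
def secCompact (U : Opens M) : Submodule ℂ (Sec F U) where
  carrier := {u | ∃ K : Set M, IsCompact K ∧ K ⊆ U ∧ support F u ⊆ K}
  zero_mem' := ⟨∅, isCompact_empty, Set.empty_subset _, by simp [support_zero]⟩
  add_mem' := by
    rintro u v ⟨K, hK, hKU, hu⟩ ⟨L, hL, hLU, hv⟩
    exact ⟨K ∪ L, hK.union hL, Set.union_subset hKU hLU,
      (support_add F _ _).trans (Set.union_subset_union hu hv)⟩
  smul_mem' := by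
    rintro c u ⟨K, hK, hKU, hu⟩
    exact ⟨K, hK, hKU, (support_smul F _ _).trans hu⟩

/-- `F_c(U)`: the space of compactly supported sections over `U`. (This is a type of its own, as its
topology is not the subspace topology.) -/
def SecC (U : Opens M) : Type v := secCompact F U

instance (U : Opens M) : AddCommGroup (SecC F U) := inferInstanceAs (AddCommGroup (secCompact F U))

instance (U : Opens M) : Module ℂ (SecC F U) := inferInstanceAs (Module ℂ (secCompact F U))

/-- The inclusion `F_K(U) → F_c(U)` for a compact subset `K` of `U`. -/
def inclSecC (U : Opens M) {K : Set M} (hK : IsCompact K) (hKU : K ⊆ U) :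
    secSupportedIn F U K →ₗ[ℂ] SecC F U :=
  Submodule.inclusion fun _ hu => ⟨K, hK, hKU, hu⟩

theorem eq_of_res_eq_of_support {U : Opens M} {w w' : Sec F ⊤}
    (h : res F (le_top : U ≤ ⊤) w = res F le_top w') (hw : support F w ⊆ U)
    (hw' : support F w' ⊆ U) : w = w' := by
  refine eq_of_locally_eq F w w' fun a _ => ?_
  by_cases ha : a ∈ U
  · exact ⟨U, le_top, ha, h⟩
  · obtain ⟨V, hV, haV, h0⟩ := (notMem_support (Opens.mem_top a)).1 fun h => ha (hw h)
    obtain ⟨V', hV', haV', h0'⟩ := (notMem_support (Opens.mem_top a)).1 fun h => ha (hw' h)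
    refine ⟨V ⊓ V', le_top, ⟨haV, haV'⟩, ?_⟩
    rw [← res_res F hV inf_le_left, ← res_res F hV' inf_le_right, h0, h0', map_zero, map_zero]

theorem exists_extension {U : Opens M} (u : SecC F U) :
    ∃ w : Sec F ⊤, res F (le_top : U ≤ ⊤) w = u.1 ∧ support F w ⊆ support F u.1 := by
  obtain ⟨u, K, hK, hKU, hu⟩ := u
  have hclosed : IsClosed (support F u) := by
    rw [← isOpen_compl_iff, isOpen_iff_forall_mem_open]
    intro a ha
    by_cases haU : a ∈ U
    · obtain ⟨V, h, haV, h0⟩ := (notMem_support haU).1 ha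
      exact ⟨V, fun b hb hb' => hb'.2 V h hb h0, V.2, haV⟩
    · exact ⟨Kᶜ, Set.compl_subset_compl.2 hu, hK.isClosed.isOpen_compl, fun h => haU (hKU h)⟩
  let Z : Opens M := ⟨(support F u)ᶜ, hclosed.isOpen_compl⟩
  have h0 : ∀ (V : Opens M) (h : V ≤ U), V ≤ Z → res F h u = 0 := by
    intro V h hZ
    refine eq_of_locally_eq F _ _ fun a ha => ?_
    obtain ⟨V', h', haV', h0⟩ := (notMem_support (h ha)).1 (hZ ha)
    refine ⟨V' ⊓ V, inf_le_right, ⟨haV', ha⟩, ?_⟩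
    rw [res_res, ← res_res F h' inf_le_left, h0, map_zero, map_zero]
  have hcov : (⨆ i : Bool, (bif i then U else Z)) = ⊤ := by
    refine top_le_iff.1 fun a _ => ?_
    simp only [Opens.mem_iSup]
    by_cases ha : a ∈ support F u
    · exact ⟨true, ha.1⟩
    · exact ⟨false, ha⟩
  obtain ⟨w, hw, -⟩ := existsUnique_gluing F (fun i : Bool => bif i then U else Z) ⊤ hcov
    (fun i => match i with | true => u | false => 0) (by
      rintro (_ | _) (_ | _)
      · rfl
      · exact (map_zero _).trans (h0 _ inf_le_right inf_le_left).symm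
      · exact (h0 _ inf_le_left inf_le_right).trans (map_zero _).symm
      · rfl)
  refine ⟨w, hw true, fun a ha => ?_⟩
  by_contra hn
  exact ha.2 Z le_top hn (hw false)

/-- The section over `M` extending a compactly supported section over `U` by zero. -/
def extension (U : Opens M) (u : SecC F U) : Sec F ⊤ := (exists_extension F u).choose

theorem res_extension (U : Opens M) (u : SecC F U) :
    res F (le_top : U ≤ ⊤) (extension F U u) = u.1 :=
  (exists_extension F u).choose_spec.1

theorem support_extension (U : Opens M) (u : SecC F U) :
    support F (extension F U u) ⊆ support F u.1 :=
  (exists_extension F u).choose_spec.2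

theorem support_extension_subset (U : Opens M) (u : SecC F U) :
    support F (extension F U u) ⊆ U :=
  (support_extension F U u).trans fun _ h => h.1

/-- Extension by zero `F_c(U) → F_c(M)`. -/
def extendByZero (U : Opens M) : SecC F U →ₗ[ℂ] SecC F ⊤ where
  toFun u := ⟨extension F U u, by
    obtain ⟨K, hK, -, hu⟩ := u.2
    exact ⟨K, hK, fun _ _ => trivial, (support_extension F U u).trans hu⟩⟩
  map_add' u v := by
    refine Subtype.ext (eq_of_res_eq_of_support F (U := U) ?_ (support_extension_subset F U _)
      ((support_add F _ _).trans (Set.union_subset (support_extension_subset F U _)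
        (support_extension_subset F U _))))
    change res F _ (extension F U (u + v)) = res F _ (extension F U u + extension F U v)
    rw [map_add, res_extension, res_extension, res_extension]
    rfl
  map_smul' c u := by
    refine Subtype.ext (eq_of_res_eq_of_support F (U := U) ?_ (support_extension_subset F U _)
      ((support_smul F _ _).trans (support_extension_subset F U _)))
    change res F _ (extension F U (c • u)) = res F _ (c • extension F U u)
    rw [map_smul, res_extension, res_extension]
    rfl

/-! ### Differential operators and the smooth topology -/

/-- `IsDiffOp A r D`: the additive map `D` between `A`-modules is a differential operator of order
at most `r`, i.e. the iterated commutators `[…[[D, f₀], f₁], …, f_r]` vanish. -/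
def IsDiffOp (A : Type*) [CommRing A] {N P : Type*} [AddCommGroup N] [AddCommGroup P] [Module A N]
    [Module A P] : ℕ → (N →+ P) → Prop
  | 0, D => ∀ (f : A) (u : N), D (f • u) - f • D u = 0
  | r + 1, D => ∀ f : A, IsDiffOp A r
      (D.comp (DistribSMul.toAddMonoidHom N f) - (DistribSMul.toAddMonoidHom P f).comp D)

/-- `Diff_c(F|_W, 𝒪_red|_W)`: compactly supported differential operators from `F` to the reduction
`𝒪_red` over the open subset `W`, i.e. morphisms of sheaves of complex vector spaces that are
locally of finite order and vanish away from a compact subset of `W`. -/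
structure DiffOpC (W : Opens M) where
  /-- the action on sections -/
  app : ∀ V : Opens M, V ≤ W → Sec F V →ₗ[ℂ] M.Reduced V
  naturality : ∀ (V V' : Opens M) (h : V ≤ W) (h' : V' ≤ V) (u : Sec F V),
    app V' (h'.trans h) (res F h' u) = M.redRes h' (app V h u)
  locally_finite_order : ∀ a ∈ W, ∃ (V : Opens M) (hV : V ≤ W) (r : ℕ), a ∈ V ∧
    ∀ (V' : Opens M) (h : V' ≤ V),
      IsDiffOp (M.Fun V') r (app V' (h.trans hV)).toAddMonoidHom
  compact_support : ∃ K : Set M, IsCompact K ∧ K ⊆ W ∧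
    ∀ (V : Opens M) (h : V ≤ W), Disjoint (V : Set M) K → app V h = 0

variable {F} in
theorem DiffOpC.bddAbove {W : Opens M} (D : DiffOpC F W) (u : Sec F W) :
    BddAbove (Set.range fun a : W => ‖(D.app W le_rfl u).1 a‖) := by
  obtain ⟨K, hK, hKW, h0⟩ := D.compact_support
  have hK' : IsCompact (Subtype.val ⁻¹' K : Set W) :=
    (Topology.IsInducing.subtypeVal.isCompact_preimage_iff (by simpa using hKW)).2 hK
  obtain ⟨C, hC⟩ := (hK'.image (M.continuous_reduced (D.app W le_rfl u)).norm).bddAbove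
  refine ⟨max C 0, ?_⟩
  rintro _ ⟨a, rfl⟩
  by_cases ha : (a : M) ∈ K
  · exact le_max_of_le_left (hC ⟨a, ha, rfl⟩)
  · let V : Opens M := W ⊓ ⟨Kᶜ, hK.isClosed.isOpen_compl⟩
    have h1 := D.naturality W V le_rfl inf_le_left u
    rw [h0 V inf_le_left (Set.disjoint_left.2 fun _ hb => hb.2)] at h1
    have h2 : (D.app W le_rfl u).1 a = 0 := (congrArg (fun φ => φ.1 ⟨a, a.2, ha⟩) h1).symm
    simp [h2]

/-- The seminorm `|u|_D = sup_{a ∈ W} |(D u)(a)|`. -/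
def smoothSeminorm (W : Opens M) (D : DiffOpC F W) : Seminorm ℂ (Sec F W) :=
  Seminorm.of (fun u => ⨆ a : W, ‖(D.app W le_rfl u).1 a‖)
    (fun u v => by
      refine Real.iSup_le (fun a => ?_)
        (add_nonneg (Real.iSup_nonneg fun _ => norm_nonneg _) (Real.iSup_nonneg fun _ => norm_nonneg _))
      rw [map_add]
      exact (norm_add_le _ _).trans
        (add_le_add (le_ciSup (D.bddAbove u) a) (le_ciSup (D.bddAbove v) a)))
    (fun c u => by
      rw [Real.mul_iSup_of_nonneg (norm_nonneg c)]
      refine iSup_congr fun a => ?_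
      rw [map_smul, ← norm_mul]
      rfl)

/-- The smooth topology on `F(W)`, defined by the seminorms `|·|_D`. -/
instance smoothTopology (W : Opens M) : TopologicalSpace (Sec F W) :=
  (SeminormFamily.moduleFilterBasis (smoothSeminorm F W)).topology

theorem withSeminorms_smoothSeminorm (W : Opens M) : WithSeminorms (smoothSeminorm F W) := ⟨rfl⟩

instance (W : Opens M) : IsTopologicalAddGroup (Sec F W) :=
  (withSeminorms_smoothSeminorm F W).topologicalAddGroup

instance (W : Opens M) : ContinuousSMul ℂ (Sec F W) :=
  (withSeminorms_smoothSeminorm F W).continuousSMul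

instance (W : Opens M) : LocallyConvexSpace ℝ (Sec F W) :=
  (withSeminorms_smoothSeminorm F W).toLocallyConvexSpace

/-! ### The inductive limit topology on `F_c(U)` and vector-valued formal distributions -/

/-- The inductive limit topology on `F_c(U) = ⋃_K F_K(U)` in the category of locally convex spaces:
the finest locally convex topology for which all the inclusions `F_K(U) → F_c(U)`, with `K ⊆ U`
compact, are continuous. Here `F_K(U)` has the subspace topology of `F(U)`. -/
instance (U : Opens M) : TopologicalSpace (SecC F U) :=
  sInf {t : TopologicalSpace (SecC F U) |
    (∀ (K : Set M) (hK : IsCompact K) (hKU : K ⊆ U), Continuous[_, t] (inclSecC F U hK hKU)) ∧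
    @IsTopologicalAddGroup (SecC F U) t _ ∧ @ContinuousSMul ℂ (SecC F U) _ _ t ∧
    @LocallyConvexSpace ℝ (SecC F U) _ _ _ _ t}

instance (U : Opens M) : IsTopologicalAddGroup (SecC F U) :=
  topologicalAddGroup_sInf fun _ h => h.2.1

instance (U : Opens M) : ContinuousSMul ℂ (SecC F U) :=
  continuousSMul_sInf fun _ h => h.2.2.1

instance (U : Opens M) : LocallyConvexSpace ℝ (SecC F U) :=
  .sInf fun _ h => h.2.2.2

theorem continuous_inclSecC (U : Opens M) {K : Set M} (hK : IsCompact K) (hKU : K ⊆ U) :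
    Continuous (inclSecC F U hK hKU) :=
  continuous_sInf_rng.2 fun _ h => h.1 K hK hKU

/-- The universal property of the topology of `F_c(U)`. -/
theorem continuous_secC_iff (U : Opens M) {V : Type*} [AddCommGroup V] [Module ℂ V]
    [TopologicalSpace V] [IsTopologicalAddGroup V] [ContinuousSMul ℂ V] [LocallyConvexSpace ℝ V]
    (L : SecC F U →ₗ[ℂ] V) :
    Continuous L ↔ ∀ (K : Set M) (hK : IsCompact K) (hKU : K ⊆ U),
      Continuous (L ∘ inclSecC F U hK hKU) := by
  refine ⟨fun h K hK hKU => h.comp (continuous_inclSecC F U hK hKU), fun h => ?_⟩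
  rw [continuous_iff_le_induced]
  refine sInf_le ⟨fun K hK hKU => continuous_induced_rng.2 (h K hK hKU),
    topologicalAddGroup_induced L, continuousSMul_induced L, ?_⟩
  exact LocallyConvexSpace.induced (L.restrictScalars ℝ)

/-- `D^{-∞}(U; F; E) = 𝓛_b(F_c(U), E)`, with the topology of uniform convergence on bounded sets. -/
abbrev Distribution (U : Opens M) (E : Type w) [AddCommGroup E] [Module ℂ E] [TopologicalSpace E] :
    Type (max v w) :=
  SecC F U →L[ℂ] E

/-- The map `D^{-∞}(M; F; E) → ∏_γ D^{-∞}(U_γ; F; E)` given by restriction, i.e. by transposing the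
extension maps `F_c(U_γ) → F_c(M)`; the argument `h` says that the latter are continuous. -/
def restriction (E : Type w) [AddCommGroup E] [Module ℂ E] [TopologicalSpace E]
    [IsTopologicalAddGroup E] [ContinuousSMul ℂ E] {Γ : Type*} (U : Γ → Opens M)
    (h : ∀ γ, Continuous (extendByZero F (U γ))) :
    Distribution F ⊤ E →ₗ[ℂ] ∀ γ, Distribution F (U γ) E where
  toFun η γ := η.comp ⟨extendByZero F (U γ), h γ⟩
  map_add' _ _ := rfl
  map_smul' _ _ := rfl

end
end FormalMfd

/-! ### Formal bump functions and functions equal to one near a compact set. -/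

namespace FormalManifold

open FormalMfd

noncomputable section

variable (M : FormalManifold.{u})

/-! The engine is a finite cutoff. For `K` compact there are finitely many formal functions `g_γ`,
each with compact support in `U_γ`, whose sum is `1` near `K` (`exists_eqOneNear_iSup`). A section
`u` supported in `K` is then `∑ g_γ u`, and `u ↦ (g_γ u)|_{U_γ}` is continuous from `F(M)` to
`F_c(U_γ)` (`exists_cutoff_decomposition`). The continuity statements rest on the fact that
differential operators can be multiplied by functions, restricted when their support allows it, and
extended by zero.

Two consequences feed an abstract criterion, `BoundedDecomposition.isClosedEmbedding`. First, a
linear map on `F_c(M)` with values in a locally convex space is continuous as soon as its composites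
with all the extensions are: on `F_K(M)` it is a finite sum of such composites with the cutoff maps.
Second, a bounded set of `F_c(M)` decomposes into a finite sum of images of bounded sets of the
`F_c(U_γ)`, provided its members have supports in a common compact set.

The last proviso is where `F(M)` being Hausdorff enters (`exists_isCompact_of_isVonNBounded`):
otherwise a sequence in the bounded set has supports meeting infinitely many members of a locally
finite cover, and separating seminorms localised there, suitably rescaled, have as supremum a
continuous seminorm that is unbounded on the sequence.

The bounded decomposition makes restriction injective and inducing. Its range is closed because a
family of distributions descends to `F_c(M)` exactly when it kills the relations among the
extensions, and each relation is a closed condition. -/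

theorem exists_gluing_fun {ι : Type u} (U : ι → Opens M) (hU : ⨆ i, U i = ⊤)
    (s : ∀ i, M.Fun (U i))
    (hs : ∀ i j, M.funRes (inf_le_left : U i ⊓ U j ≤ U i) (s i) = M.funRes inf_le_right (s j)) :
    ∃ f : M.Fun ⊤, ∀ i, M.funRes (le_top : U i ≤ ⊤) f = s i :=
  (TopCat.Sheaf.existsUnique_gluing' M.toLRS.sheaf U ⊤ (fun _ => homOfLE le_top) hU.ge s
    fun i j => hs i j).exists

/-- The ideal of formal functions on `M` with compact support contained in `U`. -/
def compactIdeal (U : Opens M) : Ideal (M.Fun ⊤) where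
  carrier := {f | ∃ L : Set M, IsCompact L ∧ L ⊆ U ∧
    ∀ V : Opens M, Disjoint (V : Set M) L → M.funRes (le_top : V ≤ ⊤) f = 0}
  zero_mem' := ⟨∅, isCompact_empty, Set.empty_subset _, fun _ _ => map_zero _⟩
  add_mem' := by
    rintro f g ⟨L, hL, hLU, hf⟩ ⟨L', hL', hLU', hg⟩
    refine ⟨L ∪ L', hL.union hL', Set.union_subset hLU hLU', fun V hV => ?_⟩
    rw [Set.disjoint_union_right] at hV
    rw [map_add, hf V hV.1, hg V hV.2, add_zero]
  smul_mem' := by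
    rintro c f ⟨L, hL, hLU, hf⟩
    refine ⟨L, hL, hLU, fun V hV => ?_⟩
    rw [smul_eq_mul, map_mul, hf V hV, mul_zero]

/-- The formal function `f` on `M` is equal to `1` on a neighborhood of the set `s`. -/
def EqOneNear (f : M.Fun ⊤) (s : Set M) : Prop :=
  ∃ N : Opens M, s ⊆ N ∧ M.funRes (le_top : N ≤ ⊤) f = 1

variable {M}

/-- The combination satisfies `1 - (f + g - f * g) = (1 - f) * (1 - g)`, which vanishes wherever one
factor does. -/
theorem EqOneNear.union {f g : M.Fun ⊤} {s t : Set M} (hf : M.EqOneNear f s)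
    (hg : M.EqOneNear g t) : M.EqOneNear (f + g - f * g) (s ∪ t) := by
  obtain ⟨N, hN, hf⟩ := hf
  obtain ⟨N', hN', hg⟩ := hg
  refine ⟨N ⊔ N', Set.union_subset_union hN hN', ?_⟩
  refine TopCat.Sheaf.eq_of_locally_eq₂ M.toLRS.sheaf (homOfLE le_sup_left : N ⟶ N ⊔ N')
    (homOfLE le_sup_right : N' ⟶ N ⊔ N') le_rfl _ _ ?_ ?_
  · change M.funRes le_sup_left (M.funRes le_top (f + g - f * g)) = M.funRes le_sup_left 1
    rw [funRes_funRes, map_sub, map_add, map_mul, map_one]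
    rw [hf]
    ring
  · change M.funRes le_sup_right (M.funRes le_top (f + g - f * g)) = M.funRes le_sup_right 1
    rw [funRes_funRes, map_sub, map_add, map_mul, map_one]
    rw [hg]
    ring

/-- An ideal is stable under `(f, g) ↦ f + g - f * g`, so local solutions combine by induction over
compact sets. This takes the place of a partition of unity. -/
theorem exists_eqOneNear_of_isCompact (J : Ideal (M.Fun ⊤)) {K : Set M} (hK : IsCompact K)
    (h : ∀ a ∈ K, ∃ f ∈ J, M.EqOneNear f {a}) : ∃ f ∈ J, M.EqOneNear f K := by
  refine hK.induction_on (p := fun s => ∃ f ∈ J, M.EqOneNear f s) ?_ ?_ ?_ ?_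
  · refine ⟨0, J.zero_mem, ⊥, Set.empty_subset _, ?_⟩
    -- Over the empty open set `0 = 1`, by the sheaf condition for the empty cover.
    have := TopCat.Sheaf.eq_of_locally_eq' M.toLRS.sheaf (fun i : PEmpty.{u+1} => (⊥ : Opens M))
      ⊥ (fun i => i.elim) bot_le
    exact this _ _ fun i => i.elim
  · rintro s t hst ⟨f, hf, N, hN, h1⟩
    exact ⟨f, hf, N, hst.trans hN, h1⟩
  · rintro s t ⟨f, hf, h1⟩ ⟨g, hg, h2⟩
    exact ⟨_, J.sub_mem (J.add_mem hf hg) (J.mul_mem_right _ hf), h1.union h2⟩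
  · intro a ha
    obtain ⟨f, hf, N, hN, h1⟩ := h a ha
    exact ⟨N, mem_nhdsWithin_of_mem_nhds (N.2.mem_nhds (hN rfl)), f, hf, N, subset_rfl, h1⟩

/-- A bump function, as a complex-valued smooth function on an open subset. -/
def bumpFun {n : ℕ} {x : EuclideanSpace ℝ (Fin n)} (φ : ContDiffBump x)
    (V : Opens (EuclideanSpace ℝ (Fin n))) : smoothFun V :=
  ⟨fun y => ((φ y : ℝ) : ℂ), by
    have h1 : ContDiff ℝ ∞ fun y => ((φ y : ℝ) : ℂ) := Complex.ofRealCLM.contDiff.comp φ.contDiff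
    exact h1.contMDiff.comp contMDiff_subtype_val⟩

/-- A smooth bump in a chart, viewed as a constant power series, is glued with `0` off the compact
set `L`; that complement is open because `M` is Hausdorff. -/
theorem exists_bump (W : Opens M) {a : M} (ha : a ∈ W) :
    ∃ f : M.Fun ⊤, ∃ (N : Opens M) (L : Set M), a ∈ N ∧ (N : Set M) ⊆ L ∧ L ⊆ W ∧ IsCompact L ∧
      M.funRes (le_top : N ≤ ⊤) f = 1 ∧
      ∀ V : Opens M, Disjoint (V : Set M) L → M.funRes (le_top : V ≤ ⊤) f = 0 := by
  obtain ⟨U, haU, n, k, ⟨C⟩⟩ := M.exists_chart a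
  obtain ⟨x, rfl⟩ : ∃ x, (C.homeo.symm x : M) = a := ⟨C.homeo ⟨a, haU⟩, by simp⟩
  have hx : x ∈ push C.homeo W := ha
  obtain ⟨r, hr, hrW⟩ := Metric.nhds_basis_closedBall.mem_iff.1 ((push C.homeo W).2.mem_nhds hx)
  let φ : ContDiffBump x := ⟨r / 2, r, by positivity, by linarith⟩
  let j : EuclideanSpace ℝ (Fin n) → M := fun y => (C.homeo.symm y : M)
  have hj : Continuous j := continuous_subtype_val.comp C.homeo.symm.continuous
  let L : Set M := j '' Metric.closedBall x r
  have hL : IsCompact L := (isCompact_closedBall x r).image hj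
  let f₀ : M.Fun (pull C.homeo ⊤) := (C.iso ⊤).symm (MvPowerSeries.C (bumpFun φ ⊤))
  have hf₀ : ∀ (V : Opens (EuclideanSpace ℝ (Fin n))),
      C.iso V (M.funRes (pull_mono C.homeo le_top) f₀) = MvPowerSeries.C (bumpFun φ V) := by
    intro V
    refine (C.iso_res ⊤ V le_top f₀).trans ?_
    rw [RingEquiv.apply_symm_apply, MvPowerSeries.map_C]
    rfl
  let V₁ : Opens (EuclideanSpace ℝ (Fin n)) := ⟨Metric.ball x (r / 2), Metric.isOpen_ball⟩
  let V₂ : Opens (EuclideanSpace ℝ (Fin n)) :=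
    ⟨(Metric.closedBall x r)ᶜ, Metric.isClosed_closedBall.isOpen_compl⟩
  have h1 : M.funRes (pull_mono C.homeo (le_top : V₁ ≤ ⊤)) f₀ = 1 := by
    refine (C.iso V₁).injective ?_
    rw [hf₀, map_one]
    rw [show bumpFun φ V₁ = 1 from ?_, map_one]
    ext y
    have := φ.one_of_mem_closedBall (Metric.ball_subset_closedBall y.2)
    simp [bumpFun, this]
  have h2 : M.funRes (pull_mono C.homeo (le_top : V₂ ≤ ⊤)) f₀ = 0 := by
    refine (C.iso V₂).injective ?_
    rw [hf₀, map_zero]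
    rw [show bumpFun φ V₂ = 0 from ?_, map_zero]
    ext y
    have := φ.zero_of_le_dist (x := y) (le_of_lt (not_le.1 fun h => y.2 h))
    simp [bumpFun, this]
  let Z : Opens M := ⟨Lᶜ, hL.isClosed.isOpen_compl⟩
  -- The overlap of the two pieces lies where the bump is zero, which gives the gluing condition.
  have hZ : pull C.homeo ⊤ ⊓ Z ≤ pull C.homeo V₂ := by
    rintro _ ⟨⟨b, -, rfl⟩, hb⟩
    refine ⟨b, fun hb' => hb ⟨C.homeo b, hb', by simp [j]⟩, rfl⟩
  have h3 : M.funRes (inf_le_left : pull C.homeo ⊤ ⊓ Z ≤ _) f₀ = 0 := by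
    rw [← M.funRes_funRes (pull_mono C.homeo (le_top : V₂ ≤ ⊤)) hZ, h2, map_zero]
  have hcov : (⨆ i : ULift.{u} Bool, (bif i.down then pull C.homeo ⊤ else Z)) = ⊤ := by
    refine top_le_iff.1 fun a _ => ?_
    simp only [Opens.mem_iSup]
    by_cases ha : a ∈ L
    · obtain ⟨y, -, rfl⟩ := ha
      exact ⟨⟨true⟩, mem_pull C.homeo trivial⟩
    · exact ⟨⟨false⟩, ha⟩
  obtain ⟨f, hf⟩ := M.exists_gluing_fun
    (fun i : ULift.{u} Bool => bif i.down then pull C.homeo ⊤ else Z) hcov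
    (fun i => match i with | ⟨true⟩ => f₀ | ⟨false⟩ => 0) (by
      rintro ⟨_ | _⟩ ⟨_ | _⟩
      · rfl
      · refine (map_zero _).trans ?_
        have := congrArg (M.funRes (le_of_eq (inf_comm Z (pull C.homeo ⊤)))) h3
        rw [funRes_funRes, map_zero] at this
        exact this.symm
      · exact h3.trans (map_zero _).symm
      · rfl)
  refine ⟨f, pull C.homeo V₁, L, mem_pull C.homeo (Metric.mem_ball_self (by positivity)), ?_, ?_,
    hL, ?_, fun V hV => ?_⟩
  · rintro _ ⟨b, hb, rfl⟩
    exact ⟨C.homeo b, Metric.closedBall_subset_closedBall (by linarith)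
      (Metric.ball_subset_closedBall hb), by simp [j]⟩
  · rintro _ ⟨y, hy, rfl⟩
    exact hrW hy
  · rw [← h1]
    have := hf ⟨true⟩
    rw [← M.funRes_funRes le_top (pull_mono C.homeo (le_top : V₁ ≤ ⊤))]
    exact congrArg _ this
  · have hVZ : V ≤ Z := fun b hb hb' => Set.disjoint_left.1 hV hb hb'
    have := hf ⟨false⟩
    rw [← M.funRes_funRes (le_top : Z ≤ ⊤) hVZ]
    exact (congrArg _ this).trans (map_zero _)

theorem exists_eqOneNear_compactIdeal {K : Set M} (hK : IsCompact K) {U : Opens M} (hKU : K ⊆ U) :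
    ∃ f ∈ M.compactIdeal U, M.EqOneNear f K := by
  refine exists_eqOneNear_of_isCompact _ hK fun a ha => ?_
  obtain ⟨f, N, L, haN, -, hLU, hL, h1, h0⟩ := exists_bump U (hKU ha)
  exact ⟨f, ⟨L, hL, hLU, h0⟩, N, Set.singleton_subset_iff.2 haN, h1⟩

/-- Membership in the supremum of ideals encodes a finite sum of functions, each compactly supported
in one `U γ`. -/
theorem exists_eqOneNear_iSup {K : Set M} (hK : IsCompact K) {Γ : Type*} {U : Γ → Opens M}
    (hU : ⨆ γ, U γ = ⊤) : ∃ f ∈ ⨆ γ, M.compactIdeal (U γ), M.EqOneNear f K := by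
  refine exists_eqOneNear_of_isCompact _ hK fun a _ => ?_
  obtain ⟨γ, hγ⟩ : ∃ γ, a ∈ U γ := by
    simpa only [Opens.mem_iSup] using hU.ge (Opens.mem_top a)
  obtain ⟨f, hf, h1⟩ := exists_eqOneNear_compactIdeal isCompact_singleton
    (Set.singleton_subset_iff.2 hγ)
  exact ⟨f, le_iSup (fun γ => M.compactIdeal (U γ)) γ hf, h1⟩

end
end FormalManifold

/-! ### Multiplication, restriction and extension of compactly supported differential operators. -/

namespace FormalMfd

noncomputable section

theorem IsDiffOp.zero (A : Type*) [CommRing A] {N P : Type*} [AddCommGroup N] [AddCommGroup P]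
    [Module A N] [Module A P] (r : ℕ) : IsDiffOp A r (0 : N →+ P) := by
  induction r with
  | zero => intro f u; simp
  | succ r ih =>
    intro f
    convert ih using 1
    ext u
    simp

/-- Multiplications commute, so `[D ∘ g, f] = [D, f] ∘ g` and the order does not grow. -/
theorem IsDiffOp.comp_smul {A : Type*} [CommRing A] {N P : Type*} [AddCommGroup N]
    [AddCommGroup P] [Module A N] [Module A P] {r : ℕ} {D : N →+ P} (hD : IsDiffOp A r D) (g : A) :
    IsDiffOp A r (D.comp (DistribSMul.toAddMonoidHom N g)) := by
  induction r generalizing D with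
  | zero =>
    intro f u
    have := hD f (g • u)
    rw [smul_comm] at this
    exact this
  | succ r ih =>
    intro f
    convert ih (hD f) using 1
    ext u
    simp [smul_comm f g u]

variable {M : FormalManifold.{u}} {F : FormalManifold.Modules.{u, v} M}

/-- `D` vanishes away from `K`. -/
def DiffOpC.SupportedIn {W : Opens M} (D : DiffOpC F W) (K : Set M) : Prop :=
  ∀ (V : Opens M) (h : V ≤ W), Disjoint (V : Set M) K → D.app V h = 0

theorem DiffOpC.apply_eq_zero {W : Opens M} (D : DiffOpC F W) {K : Set M} (hK : IsClosed K)
    (hD : D.SupportedIn K) {V : Opens M} (h : V ≤ W) (u : Sec F V) (a : V) (ha : (a : M) ∉ K) :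
    (D.app V h u).1 a = 0 := by
  let V' : Opens M := V ⊓ ⟨Kᶜ, hK.isOpen_compl⟩
  have h1 := D.naturality V V' h inf_le_left u
  rw [hD V' (inf_le_left.trans h) (Set.disjoint_left.2 fun _ hb => hb.2)] at h1
  exact (congrArg (fun φ => φ.1 ⟨a, a.2, ha⟩) h1).symm

/-- The value of `D u` at a point only depends on the restriction of `u` to a neighborhood. -/
theorem DiffOpC.app_res_apply {W : Opens M} (D : DiffOpC F W) {V V' : Opens M} (h : V ≤ W)
    (h' : V' ≤ V) (u : Sec F V) (a : V') :
    (D.app V' (h'.trans h) (res F h' u)).1 a = (D.app V h u).1 ⟨a, h' a.2⟩ :=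
  congrArg (fun φ => φ.1 a) (D.naturality V V' h h' u)

/-- Multiplication by a formal function, as a `ℂ`-linear map. -/
def smulSec (F : FormalManifold.Modules.{u, v} M) {U : Opens M} (f : M.Fun U) :
    Sec F U →ₗ[ℂ] Sec F U where
  toFun u := f • u
  map_add' := smul_add f
  map_smul' c u := by
    change f • (algebraMap ℂ (M.Fun U) c • u) = algebraMap ℂ (M.Fun U) c • (f • u)
    exact smul_comm _ _ _

@[simp]
theorem smulSec_apply {U : Opens M} (f : M.Fun U) (u : Sec F U) : smulSec F f u = f • u := rfl

/-- The differential operator `u ↦ D (f u)`. -/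
def DiffOpC.compSMul {W : Opens M} (D : DiffOpC F W) (f : M.Fun W) : DiffOpC F W where
  app V h := (D.app V h).comp (smulSec F (M.funRes h f))
  naturality V V' h h' u := by
    simp only [LinearMap.comp_apply, smulSec_apply]
    rw [← D.naturality V V' h h', res_smul, FormalManifold.funRes_funRes]
  locally_finite_order a ha := by
    obtain ⟨V, hV, r, haV, hD⟩ := D.locally_finite_order a ha
    exact ⟨V, hV, r, haV, fun V' h => (hD V' h).comp_smul _⟩
  compact_support := by
    obtain ⟨K, hK, hKW, h0⟩ := D.compact_support
    exact ⟨K, hK, hKW, fun V h hV => by rw [h0 V h hV, LinearMap.zero_comp]⟩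

theorem DiffOpC.compSMul_app {W : Opens M} (D : DiffOpC F W) (f : M.Fun W) (u : Sec F W) :
    (D.compSMul f).app W le_rfl u = D.app W le_rfl (f • u) := by
  refine congrArg (fun g : M.Fun W => D.app W le_rfl (g • u)) ?_
  exact congrArg (fun g => g.hom f) (M.toLRS.presheaf.map_id (op W))

theorem DiffOpC.compSMul_supportedIn {W : Opens M} (D : DiffOpC F W) {f : M.Fun W} {L : Set M}
    (hf : ∀ (V : Opens M) (h : V ≤ W), Disjoint (V : Set M) L → M.funRes h f = 0) :
    (D.compSMul f).SupportedIn L := by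
  intro V h hV
  ext1 u
  change D.app V h (M.funRes h f • u) = 0
  rw [hf V h hV, zero_smul, map_zero]

/-- Restriction of a differential operator on `M` with compact support in `U` to `U`. -/
def DiffOpC.restrict (D : DiffOpC F ⊤) (U : Opens M) {K : Set M} (hK : IsCompact K) (hKU : K ⊆ U)
    (hD : D.SupportedIn K) : DiffOpC F U where
  app V _ := D.app V le_top
  naturality V V' _ h' u := D.naturality V V' le_top h' u
  locally_finite_order a ha := by
    obtain ⟨V, hV, r, haV, hD⟩ := D.locally_finite_order a trivial
    exact ⟨V ⊓ U, inf_le_right, r, ⟨haV, ha⟩, fun V' h => hD V' (h.trans inf_le_left)⟩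
  compact_support := ⟨K, hK, hKU, fun V _ hV => hD V le_top hV⟩

open Classical in
/-- The values of the extension by zero of a differential operator on `U` to `M`. -/
def DiffOpC.extendFun {U : Opens M} (D : DiffOpC F U) {V : Opens M} (u : Sec F V) : M.Reduced V :=
  ⟨fun a => if ha : (a : M) ∈ U then
      (D.app (V ⊓ U) inf_le_right (res F inf_le_left u)).1 ⟨a, a.2, ha⟩ else 0, by
    intro a
    by_cases ha : (a : M) ∈ U
    · obtain ⟨W, hW, haW, f, hf⟩ :=
        (D.app (V ⊓ U) inf_le_right (res F inf_le_left u)).2 ⟨a, a.2, ha⟩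
      refine ⟨W, hW.trans inf_le_left, haW, f, fun b => ?_⟩
      rw [← hf b]
      exact dif_pos (hW b.2).2
    -- Outside `U` the point has the neighbourhood `Kᶜ`, on which the extended function is the value
    -- of the formal function `0`.
    · obtain ⟨K, hK, hKU, h0⟩ := D.compact_support
      refine ⟨V ⊓ ⟨Kᶜ, hK.isClosed.isOpen_compl⟩, inf_le_left, ⟨a.2, fun h => ha (hKU h)⟩, 0,
        fun b => ?_⟩
      rw [map_zero]
      by_cases hb : (b : M) ∈ U
      · exact (dif_pos hb).trans (D.apply_eq_zero hK.isClosed h0 _ _ _ b.2.2)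
      · exact dif_neg hb⟩

theorem DiffOpC.extendFun_apply {U : Opens M} (D : DiffOpC F U) {V : Opens M} (u : Sec F V) (a : V)
    (ha : (a : M) ∈ U) : (D.extendFun u).1 a =
      (D.app (V ⊓ U) inf_le_right (res F inf_le_left u)).1 ⟨a, a.2, ha⟩ :=
  dif_pos ha

theorem DiffOpC.extendFun_apply_of_notMem {U : Opens M} (D : DiffOpC F U) {V : Opens M}
    (u : Sec F V) (a : V) (ha : (a : M) ∉ U) : (D.extendFun u).1 a = 0 :=
  dif_neg ha

theorem DiffOpC.extendFun_of_le {U : Opens M} (D : DiffOpC F U) {V : Opens M} (h : V ≤ U)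
    (u : Sec F V) : D.extendFun u = D.app V h u := by
  ext a
  rw [D.extendFun_apply u a (h a.2)]
  exact D.app_res_apply h inf_le_left u _

/-- Extension by zero of a compactly supported differential operator on `U` to `M`. -/
def DiffOpC.extend {U : Opens M} (D : DiffOpC F U) : DiffOpC F ⊤ where
  app V _ :=
    { toFun := D.extendFun
      map_add' := fun u v => by
        ext a
        change _ = (D.extendFun u).1 a + (D.extendFun v).1 a
        by_cases ha : (a : M) ∈ U
        · rw [D.extendFun_apply _ a ha, D.extendFun_apply _ a ha, D.extendFun_apply _ a ha, map_add,
            map_add]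
          rfl
        · simp only [D.extendFun_apply_of_notMem _ a ha, add_zero]
      map_smul' := fun c u => by
        ext a
        change _ = c • (D.extendFun u).1 a
        by_cases ha : (a : M) ∈ U
        · rw [D.extendFun_apply _ a ha, D.extendFun_apply _ a ha, map_smul, map_smul]
          rfl
        · simp only [D.extendFun_apply_of_notMem _ a ha, smul_zero] }
  naturality V V' _ h' u := by
    ext a
    change (D.extendFun (res F h' u)).1 a = (D.extendFun u).1 ⟨a, h' a.2⟩
    by_cases ha : (a : M) ∈ U
    · rw [D.extendFun_apply _ a ha, D.extendFun_apply u ⟨a, h' a.2⟩ ha]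
      rw [res_res, ← res_res F (inf_le_left : V ⊓ U ≤ V) (inf_le_inf_right U h')]
      exact D.app_res_apply inf_le_right _ _ _
    · rw [D.extendFun_apply_of_notMem _ a ha, D.extendFun_apply_of_notMem u ⟨a, h' a.2⟩ ha]
  locally_finite_order a _ := by
    by_cases ha : a ∈ U
    · obtain ⟨V, hV, r, haV, hD⟩ := D.locally_finite_order a ha
      refine ⟨V, le_top, r, haV, fun V' h => ?_⟩
      convert hD V' h using 1
      ext1 u
      exact D.extendFun_of_le (h.trans hV) u
    -- Away from the support the extended operator is zero, hence of order `0`.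
    · obtain ⟨K, hK, hKU, h0⟩ := D.compact_support
      refine ⟨⟨Kᶜ, hK.isClosed.isOpen_compl⟩, le_top, 0, fun h => ha (hKU h), fun V' h => ?_⟩
      convert IsDiffOp.zero (M.Fun V') 0 using 1
      ext1 u
      change D.extendFun u = 0
      ext b
      by_cases hb : (b : M) ∈ U
      · rw [D.extendFun_apply u b hb]
        exact D.apply_eq_zero hK.isClosed h0 _ _ _ (h b.2)
      · exact D.extendFun_apply_of_notMem u b hb
  compact_support := by
    obtain ⟨K, hK, -, h0⟩ := D.compact_support
    refine ⟨K, hK, fun _ _ => trivial, fun V _ hV => ?_⟩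
    ext1 u
    change D.extendFun u = 0
    ext b
    by_cases hb : (b : M) ∈ U
    · rw [D.extendFun_apply u b hb]
      exact D.apply_eq_zero hK.isClosed h0 _ _ _ (Set.disjoint_left.1 hV b.2)
    · exact D.extendFun_apply_of_notMem u b hb

/-! ### Comparison of seminorms -/

theorem smoothSeminorm_le_iff {W : Opens M} (D : DiffOpC F W) (u : Sec F W) {C : ℝ} (hC : 0 ≤ C) :
    smoothSeminorm F W D u ≤ C ↔ ∀ a : W, ‖(D.app W le_rfl u).1 a‖ ≤ C :=
  ⟨fun h a => (le_ciSup (D.bddAbove u) a).trans h, fun h => Real.iSup_le h hC⟩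

theorem norm_le_smoothSeminorm {W : Opens M} (D : DiffOpC F W) (u : Sec F W) (a : W) :
    ‖(D.app W le_rfl u).1 a‖ ≤ smoothSeminorm F W D u :=
  le_ciSup (D.bddAbove u) a

theorem smoothSeminorm_compSMul {W : Opens M} (D : DiffOpC F W) (f : M.Fun W) (u : Sec F W) :
    smoothSeminorm F W (D.compSMul f) u = smoothSeminorm F W D (f • u) := by
  change (⨆ a : W, _) = ⨆ a : W, _
  rw [D.compSMul_app]

/-- Over `U` the operator `D.extend` is `D` itself, so its supremum over `M` dominates. -/
theorem smoothSeminorm_res_le {U : Opens M} (D : DiffOpC F U) (u : Sec F ⊤) :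
    smoothSeminorm F U D (res F le_top u) ≤ smoothSeminorm F ⊤ D.extend u := by
  rw [smoothSeminorm_le_iff _ _ (apply_nonneg _ _)]
  intro a
  refine le_trans (le_of_eq ?_) (norm_le_smoothSeminorm D.extend u ⟨a, trivial⟩)
  have h1 := D.extend.app_res_apply le_rfl (le_top : U ≤ ⊤) u a
  rw [← h1]
  congr 2
  exact congrArg (fun φ => φ.1 a) (D.extendFun_of_le le_rfl (res F le_top u)).symm

/-- `D u` vanishes off `K`, so only points of `U` contribute to the supremum. -/
theorem smoothSeminorm_le_restrict (D : DiffOpC F ⊤) (U : Opens M) {K : Set M} (hK : IsCompact K)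
    (hKU : K ⊆ U) (hD : D.SupportedIn K) (u : Sec F ⊤) :
    smoothSeminorm F ⊤ D u ≤ smoothSeminorm F U (D.restrict U hK hKU hD) (res F le_top u) := by
  rw [smoothSeminorm_le_iff _ _ (apply_nonneg _ _)]
  intro a
  by_cases ha : (a : M) ∈ K
  · refine le_trans (le_of_eq ?_) (norm_le_smoothSeminorm _ _ ⟨a, hKU ha⟩)
    exact congrArg _ (D.app_res_apply le_rfl (le_top : U ≤ ⊤) u ⟨a, hKU ha⟩).symm
  · rw [D.apply_eq_zero hK.isClosed hD _ _ _ ha, norm_zero]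
    exact apply_nonneg _ _

theorem continuous_smulSec {W : Opens M} (f : M.Fun W) : Continuous (smulSec F f) :=
  WithSeminorms.continuous_of_isBounded (withSeminorms_smoothSeminorm F W)
    (withSeminorms_smoothSeminorm F W) _ fun D =>
      ⟨{D.compSMul f}, 1, fun u => by
        simpa using (smoothSeminorm_compSMul D f u).ge⟩

theorem continuous_res_top (U : Opens M) : Continuous (res F (le_top : U ≤ ⊤)) :=
  WithSeminorms.continuous_of_isBounded (withSeminorms_smoothSeminorm F ⊤)
    (withSeminorms_smoothSeminorm F U) _ fun D =>
      ⟨{D.extend}, 1, fun u => by simpa using smoothSeminorm_res_le D u⟩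

end
end FormalMfd

/-! ### Spaces of continuous linear maps out of a colimit -/

section Abstract

open Bornology

variable {Γ X E : Type*} {Y : Γ → Type*} [AddCommGroup X] [Module ℂ X] [TopologicalSpace X]
  [∀ γ, AddCommGroup (Y γ)] [∀ γ, Module ℂ (Y γ)] [∀ γ, TopologicalSpace (Y γ)]
  [AddCommGroup E] [Module ℂ E] [TopologicalSpace E] [IsTopologicalAddGroup E]
  [ContinuousSMul ℂ E]

/-- Every bounded subset of `X` is contained in a finite sum of images of bounded sets under the
maps `e γ : Y γ → X`. -/
def BoundedDecomposition (e : ∀ γ, Y γ →L[ℂ] X) : Prop :=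
  ∀ B : Set X, IsVonNBounded ℂ B → ∃ (s : Finset Γ) (C : ∀ γ, Set (Y γ)),
    (∀ γ, IsVonNBounded ℂ (C γ)) ∧
      ∀ x ∈ B, ∃ y : ∀ γ, Y γ, (∀ γ, y γ ∈ C γ) ∧ ∑ γ ∈ s, e γ (y γ) = x

theorem BoundedDecomposition.exists_sum_eq [ContinuousSMul ℂ X] {e : ∀ γ, Y γ →L[ℂ] X} (he : BoundedDecomposition e)
    (x : X) : ∃ (s : Finset Γ) (y : ∀ γ, Y γ), ∑ γ ∈ s, e γ (y γ) = x := by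
  obtain ⟨s, C, -, h⟩ := he {x} (isVonNBounded_singleton x)
  obtain ⟨y, -, hy⟩ := h x rfl
  exact ⟨s, y, hy⟩

theorem BoundedDecomposition.isInducing {e : ∀ γ, Y γ →L[ℂ] X} (he : BoundedDecomposition e)
    (R : (X →L[ℂ] E) →ₗ[ℂ] ∀ γ, Y γ →L[ℂ] E) (hR : ∀ η γ, R η γ = η.comp (e γ)) :
    IsInducing R := by
  refine (IsTopologicalAddGroup.isInducing_iff_nhds_zero (f := R)).2 (le_antisymm ?_ ?_)
  · rw [← Filter.tendsto_iff_comap]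
    have : Continuous R := by
      refine continuous_pi fun γ => ?_
      rw [show (fun η => R η γ) = ContinuousLinearMap.precomp E (e γ) from funext fun η => hR η γ]
      exact (ContinuousLinearMap.precomp E (e γ)).continuous
    exact this.tendsto' 0 0 (map_zero R)
  · rw [(ContinuousLinearMap.hasBasis_nhds_zero).ge_iff]
    rintro ⟨B, V⟩ ⟨hB, hV⟩
    obtain ⟨s, C, hC, hBC⟩ := he B hB
    have hsum : Continuous fun y : Γ → E => ∑ γ ∈ s, y γ :=
      continuous_finsetSum s fun γ _ => continuous_apply γ
    have h1 : (fun y : Γ → E => ∑ γ ∈ s, y γ) ⁻¹' V ∈ 𝓝 (0 : Γ → E) :=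
      hsum.tendsto' 0 0 (by simp) hV
    rw [nhds_pi, Filter.mem_pi] at h1
    obtain ⟨I, hI, t, ht, hIt⟩ := h1
    -- The finite set `I` need not be related to `s`; this is why the decomposition asks for `y γ ∈
    -- C γ` at every index.
    refine ⟨I.pi fun γ => {θ : Y γ →L[ℂ] E | Set.MapsTo θ (C γ) (t γ)}, ?_, ?_⟩
    · exact set_pi_mem_nhds hI fun γ _ =>
        ContinuousLinearMap.eventually_nhds_zero_mapsTo (hC γ) (ht γ)
    · intro η hη x hx
      obtain ⟨y, hy, rfl⟩ := hBC x hx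
      have h2 : (fun γ => η (e γ (y γ))) ∈ I.pi t := by
        intro γ hγ
        have h3 := hη γ hγ (hy γ)
        rw [hR] at h3
        exact h3
      have h4 := hIt h2
      rw [map_sum]
      exact h4

/-- A family `θ` comes from `X` exactly when the map it induces on `⨁ Y γ` kills the kernel of `⨁ Y
γ → X`: it then descends linearly, and `hcont` gives continuity. Evaluation at a fixed element of
the direct sum is continuous in `θ`, so, `E` being Hausdorff, these conditions are closed. -/
theorem isClosed_range_of_factor [∀ γ, ContinuousSMul ℂ (Y γ)] [T2Space E]
    {e : ∀ γ, Y γ →L[ℂ] X}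
    (hsurj : ∀ x : X, ∃ (s : Finset Γ) (y : ∀ γ, Y γ), ∑ γ ∈ s, e γ (y γ) = x)
    (hcont : ∀ L : X →ₗ[ℂ] E, (∀ γ, Continuous fun y => L (e γ y)) → Continuous L)
    (R : (X →L[ℂ] E) →ₗ[ℂ] ∀ γ, Y γ →L[ℂ] E) (hR : ∀ η γ, R η γ = η.comp (e γ)) :
    IsClosed (Set.range R) := by
  classical
  let Φ : DirectSum Γ Y →ₗ[ℂ] X := DirectSum.toModule ℂ Γ X fun γ => (e γ).toLinearMap
  let Ψ : (∀ γ, Y γ →L[ℂ] E) → DirectSum Γ Y →ₗ[ℂ] E := fun θ =>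
    DirectSum.toModule ℂ Γ E fun γ => (θ γ).toLinearMap
  have hΦ : ∀ γ y, Φ (DirectSum.lof ℂ Γ Y γ y) = e γ y := fun γ y =>
    DirectSum.toModule_lof ℂ γ y
  have hΨ : ∀ θ γ y, Ψ θ (DirectSum.lof ℂ Γ Y γ y) = θ γ y := fun θ γ y =>
    DirectSum.toModule_lof ℂ γ y
  have hΦs : Function.Surjective Φ := fun x => by
    obtain ⟨s, y, rfl⟩ := hsurj x
    exact ⟨∑ γ ∈ s, DirectSum.lof ℂ Γ Y γ (y γ), by simp only [map_sum, hΦ]⟩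
  have hΨc : ∀ z, Continuous fun θ => Ψ θ z := by
    intro z
    induction z using DirectSum.induction_on with
    | zero => simpa only [map_zero] using continuous_const
    | of γ y =>
      have : (fun θ => Ψ θ (DirectSum.of Y γ y)) = fun θ => θ γ y := by
        ext1 θ
        exact hΨ θ γ y
      rw [this]
      exact (continuous_eval_const y).comp (continuous_apply γ)
    | add z z' hz hz' => 
      simp only [map_add]
      exact hz.add hz'
  have hrange : Set.range R = ⋂ z ∈ LinearMap.ker Φ, {θ | Ψ θ z = 0} := by
    ext θ
    simp only [Set.mem_range, Set.mem_iInter, Set.mem_ofPred_eq, LinearMap.mem_ker]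
    constructor
    · rintro ⟨η, rfl⟩ z hz
      have h1 : Ψ (R η) = η.toLinearMap ∘ₗ Φ := by
        refine DirectSum.linearMap_ext ℂ fun γ => LinearMap.ext fun y => ?_
        simp only [LinearMap.comp_apply, hΨ, hΦ, hR]
        rfl
      rw [h1, LinearMap.comp_apply, hz, map_zero]
    · intro hθ
      obtain ⟨L, hL⟩ : ∃ L : X →ₗ[ℂ] E, ∀ z, L (Φ z) = Ψ θ z := by
        refine ⟨(LinearMap.ker Φ).liftQ (Ψ θ) (fun z hz => hθ z hz) ∘ₗ
          (Φ.quotKerEquivOfSurjective hΦs).symm.toLinearMap, fun z => ?_⟩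
        have : (Φ.quotKerEquivOfSurjective hΦs).symm (Φ z) = Submodule.Quotient.mk z := by
          rw [LinearEquiv.symm_apply_eq]
          rfl
        rw [LinearMap.comp_apply, LinearEquiv.coe_coe, this]
        rfl
      have hLe : ∀ γ y, L (e γ y) = θ γ y := fun γ y => by rw [← hΦ, hL, hΨ]
      refine ⟨⟨L, hcont L fun γ => ?_⟩, ?_⟩
      · simpa only [hLe] using (θ γ).continuous
      · ext γ y
        rw [hR]
        exact hLe γ y
  rw [hrange]
  exact isClosed_biInter fun z _ => isClosed_eq (hΨc z) continuous_const

theorem BoundedDecomposition.isClosedEmbedding [ContinuousSMul ℂ X]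
    [∀ γ, ContinuousSMul ℂ (Y γ)] [T2Space E] {e : ∀ γ, Y γ →L[ℂ] X}
    (he : BoundedDecomposition e)
    (hcont : ∀ L : X →ₗ[ℂ] E, (∀ γ, Continuous fun y => L (e γ y)) → Continuous L)
    (R : (X →L[ℂ] E) →ₗ[ℂ] ∀ γ, Y γ →L[ℂ] E) (hR : ∀ η γ, R η γ = η.comp (e γ)) :
    IsClosedEmbedding R := by
  refine ⟨⟨he.isInducing R hR, ?_⟩, isClosed_range_of_factor he.exists_sum_eq hcont R hR⟩
  rw [injective_iff_map_eq_zero]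
  intro η hη
  ext x
  obtain ⟨s, y, rfl⟩ := he.exists_sum_eq x
  rw [map_sum]
  refine Finset.sum_eq_zero fun γ _ => ?_
  have := congrArg (fun θ : ∀ γ, Y γ →L[ℂ] E => θ γ (y γ)) hη
  simpa [hR] using this

end Abstract

/-! ### Cutoffs and continuity of extension by zero. -/

namespace FormalMfd

noncomputable section

open Bornology FormalManifold

variable {M : FormalManifold.{u}} {F : FormalManifold.Modules.{u, v} M}

/-- Near a point of `K` the factor is `1`; near any other point `u` is zero. -/
theorem smul_eq_self_of_eqOneNear {f : M.Fun ⊤} {K : Set M} (hf : M.EqOneNear f K) {u : Sec F ⊤}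
    (hu : support F u ⊆ K) : f • u = u := by
  obtain ⟨N, hN, h1⟩ := hf
  refine eq_of_locally_eq F _ _ fun a _ => ?_
  by_cases ha : a ∈ K
  · exact ⟨N, le_top, hN ha, by rw [res_smul, h1, one_smul]⟩
  · obtain ⟨V, hV, haV, h0⟩ := (notMem_support (Opens.mem_top a)).1 fun h => ha (hu h)
    exact ⟨V, hV, haV, by rw [res_smul, h0, smul_zero]⟩

theorem support_res_smul_subset {f : M.Fun ⊤} {L : Set M} (hL : IsClosed L)
    (hf : ∀ V : Opens M, Disjoint (V : Set M) L → M.funRes (le_top : V ≤ ⊤) f = 0) (U : Opens M)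
    (u : Sec F ⊤) : support F (res F (le_top : U ≤ ⊤) (f • u)) ⊆ L := by
  intro a ha
  by_contra haL
  let V : Opens M := U ⊓ ⟨Lᶜ, hL.isOpen_compl⟩
  have hV : Disjoint (V : Set M) L := Set.disjoint_left.2 fun _ hb => hb.2
  refine ha.2 V inf_le_left ⟨ha.1, haL⟩ ?_
  rw [res_res, res_smul, hf V hV, zero_smul]

/-- Extension by zero is continuous. -/
theorem continuous_extendByZero (U : Opens M) : Continuous (extendByZero F U) := by
  rw [continuous_secC_iff]
  intro K hK hKU
  -- The support of an operator `D` on `M` need not lie in `U`, but `f` is `1` near `K`, so `|T u|_D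
  -- = |f • T u|_D` is the seminorm of `D.compSMul f`, which is supported in `L ⊆ U` and restricts
  -- to `U`.
  obtain ⟨f, ⟨L, hL, hLU, hf⟩, h1⟩ := exists_eqOneNear_compactIdeal hK hKU
  let T : secSupportedIn F U K →ₗ[ℂ] Sec F ⊤ :=
    (secCompact F ⊤).subtype ∘ₗ extendByZero F U ∘ₗ inclSecC F U hK hKU
  have hT : ∀ u, support F (T u) ⊆ K := fun u => (support_extension F U _).trans u.2
  have hres : ∀ u, res F (le_top : U ≤ ⊤) (T u) = u.1 := fun u => res_extension F U _
  have hTc : Continuous T := by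
    refine WithSeminorms.continuous_of_continuous_comp (withSeminorms_smoothSeminorm F ⊤) _
      fun D => ?_
    have hD : (D.compSMul f).SupportedIn L := D.compSMul_supportedIn fun V _ hV => hf V hV
    refine Seminorm.continuous_of_le (q := (smoothSeminorm F U
      ((D.compSMul f).restrict U hL hLU hD)).comp (secSupportedIn F U K).subtype) ?_ ?_
    · exact ((withSeminorms_smoothSeminorm F U).continuous_seminorm _).comp continuous_subtype_val
    · intro u
      refine le_trans (le_of_eq ?_)
        ((smoothSeminorm_le_restrict (D.compSMul f) U hL hLU hD (T u)).trans (le_of_eq ?_))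
      · rw [smoothSeminorm_compSMul, smul_eq_self_of_eqOneNear h1 (hT u)]
        rfl
      · rw [hres]
        rfl
  have : (extendByZero F U ∘ inclSecC F U hK hKU : secSupportedIn F U K → SecC F ⊤) =
      inclSecC F ⊤ hK (fun _ _ => trivial) ∘ T.codRestrict (secSupportedIn F ⊤ K) hT := rfl
  rw [this]
  exact (continuous_inclSecC F ⊤ hK _).comp (hTc.subtype_mk _)

/-- For `f` compactly supported in `U`, the map `u ↦ (f u)|_U`. -/
theorem exists_cutoffMap {U : Opens M} {f : M.Fun ⊤} (hf : f ∈ M.compactIdeal U) :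
    ∃ T : Sec F ⊤ →L[ℂ] SecC F U, ∀ u, (extendByZero F U (T u)).1 = f • u := by
  obtain ⟨L, hL, hLU, hf⟩ := hf
  -- All values are supported in the one compact set `L`, so continuity can be checked in the
  -- topology of `F(U)`.
  let T : Sec F ⊤ →ₗ[ℂ] secSupportedIn F U L :=
    (res F le_top ∘ₗ smulSec F f).codRestrict _ (support_res_smul_subset hL.isClosed hf U)
  have hT : Continuous T :=
    ((continuous_res_top U).comp (continuous_smulSec f)).subtype_mk _
  refine ⟨⟨inclSecC F U hL hLU ∘ₗ T, (continuous_inclSecC F U hL hLU).comp hT⟩, fun u => ?_⟩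
  refine eq_of_res_eq_of_support F (U := U) ?_ (support_extension_subset F U _) ?_
  · exact res_extension F U _
  · have := support_res_smul_subset hL.isClosed hf ⊤ u
    rw [res_self] at this
    exact this.trans hLU

/-- The index set and the maps depend only on `K`, not on `u`; this uniformity gives both the
splitting of bounded sets and the continuity criterion. -/
theorem exists_cutoff_decomposition {Γ : Type*} {U : Γ → Opens M} (hU : ⨆ γ, U γ = ⊤)
    {K : Set M} (hK : IsCompact K) :
    ∃ (s : Finset Γ) (T : ∀ γ, Sec F ⊤ →L[ℂ] SecC F (U γ)), ∀ u : Sec F ⊤, support F u ⊆ K →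
      ∑ γ ∈ s, (extendByZero F (U γ) (T γ u)).1 = u := by
  obtain ⟨f, hf, h1⟩ := exists_eqOneNear_iSup hK hU
  obtain ⟨g, hg, rfl⟩ := (Submodule.mem_iSup_iff_exists_finsupp _ _).1 hf
  choose T hT using fun γ => exists_cutoffMap (F := F) (hg γ)
  refine ⟨g.support, T, fun u hu => ?_⟩
  simp only [hT]
  rw [← Finset.sum_smul]
  exact smul_eq_self_of_eqOneNear h1 hu

/-! ### Bounded subsets of `F_c(M)` -/

/-- The topology of `p` alone is one of those whose infimum defines `F_c(U)`, so a bounded set stays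
bounded for it. -/
theorem exists_bound_of_seminorm {U : Opens M} (p : Seminorm ℂ (SecC F U))
    (hp : ∀ (K : Set M) (hK : IsCompact K) (hKU : K ⊆ U),
      Continuous (p.comp (inclSecC F U hK hKU))) {B : Set (SecC F U)} (hB : IsVonNBounded ℂ B) :
    ∃ R, ∀ u ∈ B, p u < R := by
  let P : SeminormFamily ℂ (SecC F U) Unit := fun _ => p
  let t : TopologicalSpace (SecC F U) := P.moduleFilterBasis.topology
  have ht : WithSeminorms (topology := t) P := ⟨rfl⟩
  have hle : instTopologicalSpaceSecC F U ≤ t := by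
    refine sInf_le ⟨fun K hK hKU => ?_, ht.topologicalAddGroup, ht.continuousSMul,
      ht.toLocallyConvexSpace⟩
    exact WithSeminorms.continuous_of_continuous_comp ht _ fun _ => hp K hK hKU
  have hB' := hB.of_topologicalSpace_le hle
  obtain ⟨R, -, hR⟩ := (ht.isVonNBounded_iff_seminorm_bounded).1 hB' ()
  exact ⟨R, hR⟩

/-- The continuous inclusion `F_c(M) → F(M)`. -/
def secCToSec (F : FormalManifold.Modules.{u, v} M) (U : Opens M) : SecC F U →L[ℂ] Sec F U :=
  ⟨(secCompact F U).subtype, (continuous_secC_iff F U _).2 fun _ _ _ => continuous_subtype_val⟩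

/-- Multiplying `u` by a cutoff near `a` leaves a nonzero section, which some `D` detects because
`F(M)` is Hausdorff; moving the cutoff into `D` localises the operator in `W`. -/
theorem exists_diffOp_ne_zero [T2Space (Sec F ⊤)] {u : Sec F ⊤} {a : M} (ha : a ∈ support F u)
    {W : Opens M} (haW : a ∈ W) :
    ∃ (D : DiffOpC F ⊤) (L : Set M), IsClosed L ∧ L ⊆ W ∧ D.SupportedIn L ∧
      smoothSeminorm F ⊤ D u ≠ 0 := by
  obtain ⟨f, ⟨L, hL, hLW, hf⟩, N, haN, h1⟩ := exists_eqOneNear_compactIdeal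
    (isCompact_singleton (x := a)) (Set.singleton_subset_iff.2 haW)
  have hne : f • u ≠ 0 := by
    intro h0
    refine ha.2 N le_top (haN rfl) ?_
    have := congrArg (res F (le_top : N ≤ ⊤)) h0
    rwa [res_smul, h1, one_smul, map_zero] at this
  obtain ⟨D, hD⟩ := (withSeminorms_smoothSeminorm F ⊤).separating_of_T1 _ hne
  exact ⟨D.compSMul f, L, hL.isClosed, hLW, D.compSMul_supportedIn fun V _ hV => hf V hV,
    by rwa [smoothSeminorm_compSMul]⟩

theorem smoothSeminorm_eq_zero {D : DiffOpC F ⊤} {L : Set M} (hL : IsClosed L)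
    (hD : D.SupportedIn L) {u : Sec F ⊤} (hu : Disjoint (support F u) L) :
    smoothSeminorm F ⊤ D u = 0 := by
  refine le_antisymm ((smoothSeminorm_le_iff D u le_rfl).2 fun a => ?_) (apply_nonneg _ _)
  refine (norm_eq_zero.2 ?_).le
  by_cases ha : (a : M) ∈ support F u
  · exact D.apply_eq_zero hL hD _ _ _ (Set.disjoint_left.1 hu ha)
  · obtain ⟨V, hV, haV, h0⟩ := (notMem_support (Opens.mem_top (a : M))).1 ha
    have := D.app_res_apply le_rfl hV u ⟨a, haV⟩
    rw [h0, map_zero] at this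
    exact this.symm

/-- A bounded subset of `F_c(M)` consists of sections with supports in a common compact set. -/
theorem exists_isCompact_of_isVonNBounded [T2Space (Sec F ⊤)] {B : Set (SecC F ⊤)}
    (hB : IsVonNBounded ℂ B) : ∃ K : Set M, IsCompact K ∧ ∀ u ∈ B, support F u.1 ⊆ K := by
  have hloc : ∀ a : M, ∃ (N : Opens M) (L : Set M), a ∈ N ∧ (N : Set M) ⊆ L ∧ IsCompact L := by
    intro a
    obtain ⟨-, N, L, haN, hNL, -, hL, -⟩ := exists_bump ⊤ (Opens.mem_top a)
    exact ⟨N, L, haN, hNL, hL⟩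
  choose N L haN hNL hL using hloc
  obtain ⟨v, hvo, hvc, hvf, hvN⟩ := precise_refinement (fun a => (N a : Set M)) (fun a => (N a).2)
    (Set.eq_univ_of_forall fun a => Set.mem_iUnion.2 ⟨a, haN a⟩)
  -- `I` indexes the members of the locally finite cover met by supports from `B`; each member lies
  -- in a compact set, so finiteness of `I` suffices.
  let I : Set M := {i | ∃ u ∈ B, (support F u.1 ∩ v i).Nonempty}
  by_cases hI : I.Finite
  · refine ⟨⋃ i ∈ I, L i, hI.isCompact_biUnion fun i _ => hL i, fun u hu a ha => ?_⟩
    obtain ⟨i, hi⟩ := Set.mem_iUnion.1 (hvc.ge (Set.mem_univ a))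
    exact Set.mem_biUnion (x := i) ⟨u, hu, a, ha, hi⟩ (hNL i (hvN i hi))
  · exfalso
    let j : ℕ ↪ I := Set.Infinite.natEmbedding I hI
    choose u huB a hau hav using fun n => (j n).2
    choose D L' hL' hLv hD hDu using fun n =>
      exists_diffOp_ne_zero (hau n) (W := ⟨v (j n), hvo _⟩) (hav n)
    let c : ℕ → ℝ := fun n => smoothSeminorm F ⊤ (D n) (u n).1
    have hc : ∀ n, 0 < c n := fun n => lt_of_le_of_ne (apply_nonneg _ _) (hDu n).symm
    -- The scaling is chosen so that `q n` takes the value `n` at `u n`, while `q n` only sees what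
    -- happens in `v (j n)`.
    let q : ℕ → Seminorm ℂ (SecC F ⊤) := fun n =>
      (n / c n).toNNReal • (smoothSeminorm F ⊤ (D n)).comp (secCompact F ⊤).subtype
    have hqu : ∀ n, q n (u n) = n := by
      intro n
      change ((n / c n).toNNReal : ℝ) * c n = n
      rw [Real.coe_toNNReal _ (div_nonneg n.cast_nonneg (hc n).le), div_mul_cancel₀ _ (hc n).ne']
    have hq0 : ∀ n w, Disjoint (support F w.1) (v (j n)) → q n w = 0 := by
      intro n w hw
      change ((n / c n).toNNReal : ℝ) * smoothSeminorm F ⊤ (D n) w.1 = 0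
      rw [smoothSeminorm_eq_zero (hL' n) (hD n) (hw.mono_right (hLv n)), mul_zero]
    -- By local finiteness `K` meets finitely many `v (j n)`, so on `F_K(M)` the supremum of all `q
    -- n` is a finite maximum, hence continuous.
    have hfin : ∀ K : Set M, IsCompact K → ∃ s : Finset ℕ, ∀ w : SecC F ⊤, support F w.1 ⊆ K →
        ∀ n, q n w ≤ s.sup q w := by
      intro K hK
      have hf := (hvf.comp_injective (Subtype.val_injective.comp j.injective)
        ).finite_nonempty_inter_compact hK
      refine ⟨hf.toFinset, fun w hw n => ?_⟩
      by_cases hn : n ∈ hf.toFinset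
      · exact Seminorm.le_finset_sup_apply hn
      · rw [hq0 n w]
        · exact apply_nonneg _ _
        · rw [Set.Finite.mem_toFinset, Set.mem_ofPred_eq, Set.not_nonempty_iff_eq_empty] at hn
          exact (Set.disjoint_iff_inter_eq_empty.2 hn).symm.mono_left hw
    have hbdd : BddAbove (Set.range q) := by
      rw [Seminorm.bddAbove_range_iff]
      intro w
      obtain ⟨K, hK, -, hw⟩ := w.2
      obtain ⟨s, hs⟩ := hfin K hK
      exact ⟨s.sup q w, Set.forall_mem_range.2 (hs w hw)⟩
    obtain ⟨R, hR⟩ := exists_bound_of_seminorm (⨆ n, q n) (fun K hK hKU => by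
      obtain ⟨s, hs⟩ := hfin K hK
      refine Seminorm.continuous_of_le (q := (s.sup q).comp (inclSecC F ⊤ hK hKU)) ?_ ?_
      · have hsup : Continuous ⇑(s.sup q : Seminorm ℂ (SecC F ⊤)) := Seminorm.continuous_finsetSup fun n _ =>
          (((withSeminorms_smoothSeminorm F ⊤).continuous_seminorm (D n)).comp
            (secCToSec F ⊤).continuous).const_smul _
        exact hsup.comp (continuous_inclSecC F ⊤ hK hKU)
      · intro w
        rw [Seminorm.comp_apply, Seminorm.comp_apply, Seminorm.iSup_apply hbdd]
        exact ciSup_le fun n => hs (inclSecC F ⊤ hK hKU w) w.2 n) hB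
    obtain ⟨n, hn⟩ := exists_nat_gt R
    have h1 := hR (u n) (huB n)
    rw [Seminorm.iSup_apply hbdd] at h1
    have h2 := le_ciSup (Seminorm.bddAbove_range_iff.1 hbdd (u n)) n
    rw [hqu] at h2
    linarith

/-! ### Bounded decomposition and the continuity criterion for the cover. -/

/-- Extension by zero as a continuous linear map. -/
def extendByZeroL (F : FormalManifold.Modules.{u, v} M) (U : Opens M) : SecC F U →L[ℂ] SecC F ⊤ :=
  ⟨extendByZero F U, continuous_extendByZero U⟩

theorem coe_sum_secC {ι : Type*} {U : Opens M} (s : Finset ι) (w : ι → SecC F U) :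
    (∑ i ∈ s, w i).1 = ∑ i ∈ s, (w i).1 :=
  map_sum (secCompact F U).subtype w s

theorem boundedDecomposition_extendByZeroL [T2Space (Sec F ⊤)] {Γ : Type*} {U : Γ → Opens M}
    (hU : ⨆ γ, U γ = ⊤) : BoundedDecomposition fun γ => extendByZeroL F (U γ) := by
  intro B hB
  obtain ⟨K, hK, hBK⟩ := exists_isCompact_of_isVonNBounded hB
  obtain ⟨s, T, hT⟩ := exists_cutoff_decomposition (F := F) hU hK
  -- The bounded pieces are the images of `B` under the continuous cutoff maps.
  refine ⟨s, fun γ => ((T γ).comp (secCToSec F ⊤)) '' B, fun γ => hB.image _, fun u hu => ?_⟩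
  refine ⟨fun γ => T γ u.1, fun γ => ⟨u, hu, rfl⟩, Subtype.ext ?_⟩
  rw [coe_sum_secC]
  exact hT u.1 (hBK u hu)

/-- On each `F_K(M)` the cutoff decomposition writes `L` as a finite sum of continuous maps. -/
theorem continuous_of_comp_extendByZeroL {Γ : Type*} {U : Γ → Opens M} (hU : ⨆ γ, U γ = ⊤)
    {E : Type*} [AddCommGroup E] [Module ℂ E] [TopologicalSpace E] [IsTopologicalAddGroup E]
    [ContinuousSMul ℂ E] [LocallyConvexSpace ℝ E] (L : SecC F ⊤ →ₗ[ℂ] E)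
    (h : ∀ γ, Continuous fun u => L (extendByZeroL F (U γ) u)) : Continuous L := by
  rw [continuous_secC_iff]
  intro K hK hKU
  obtain ⟨s, T, hT⟩ := exists_cutoff_decomposition (F := F) hU hK
  have h1 : (L ∘ inclSecC F ⊤ hK hKU : secSupportedIn F ⊤ K → E) =
      fun u => ∑ γ ∈ s, L (extendByZeroL F (U γ) (T γ u.1)) := by
    funext u
    rw [← map_sum]
    refine congrArg L (Subtype.ext ?_)
    rw [coe_sum_secC]
    exact (hT u.1 u.2).symm
  rw [h1]
  exact continuous_finsetSum s fun γ _ =>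
    (h γ).comp ((T γ).continuous.comp continuous_subtype_val)

end
end FormalMfd

theorem mainTheorem7 (M : FormalManifold.{u}) (F : FormalManifold.Modules.{u, v} M)
    (E : Type w) [AddCommGroup E] [Module ℂ E] [UniformSpace E] [IsUniformAddGroup E]
    [ContinuousSMul ℂ E] [LocallyConvexSpace ℝ E] [T2Space E] [QuasiCompleteSpace ℂ E]
    (hF : T2Space (FormalMfd.Sec F ⊤))
    {Γ : Type*} (U : Γ → Opens M) (hU : ⨆ γ, U γ = ⊤) :
    ∃ h : ∀ γ, Continuous (FormalMfd.extendByZero F (U γ)),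
      IsClosedEmbedding (FormalMfd.restriction F E U h) := 
    ⟨fun γ => FormalMfd.continuous_extendByZero (U γ),
      (FormalMfd.boundedDecomposition_extendByZeroL hU).isClosedEmbedding
        (FormalMfd.continuous_of_comp_extendByZeroL hU) _ fun _ _ => rfl⟩
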